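/- Let $A,B\in\mathbb C^{2\times 2}$ with $\operatorname{Rank}(A\ B)=2$ be regular boundary conditions, i.e. $A+ikB$ is invertible for some $k\in\mathbb C$. Let $\Delta(A,B)$ be the operator $\psi\mapsto\psi''$ in $L^2([0,\infty);\mathbb C)\oplus L^2([0,\infty);\mathbb C)$ whose domain consists of all $\psi=(\psi_1,\psi_2)\in H^2([0,\infty))\oplus H^2([0,\infty))$ with $$A\begin{bmatrix}\psi_1(0)\\ \psi_2(0)\end{bmatrix}+B\begin{bmatrix}\psi_1'(0)\\ \psi_2'(0)\end{bmatrix}=0 .$$ Assume that $\Delta(A,B)$ generates a contractive $C_0$-semigroup $(T(t))_{t\ge 0}$ on $L^2([0,\infty))\oplus L^2([0,\infty))$. Let $\mathfrak S(k;A,B)=-(A+ikB)^{-1}(A-ikB)$ be the Cayley transform and write $\sigma_{ij}(i\kappa)=(\mathfrak S(i\kappa;A,B))_{ij}$, $1\le i,j\le 2$, for $\kappa>0$. (1) Let $C\subset\mathbb C^2$ be closed and convex, and let $$\mathcal C=\{f=(f_1,f_2)\in L^2([0,\infty))\oplus L^2([0,\infty)) : (f_1(x),f_2(x))\in C \text{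 for a.e. } x\in[0,\infty)\}.$$ If the matrix $$\frac{\kappa}{2}\begin{bmatrix} e^{-\kappa|x_1-y_1|}+e^{-\kappa(x_1+y_1)}\sigma_{11}(i\kappa) & e^{-\kappa(x_1+y_2)}\sigma_{12}(i\kappa)\\ e^{-\kappa(x_2+y_1)}\sigma_{21}(i\kappa) & e^{-\kappa|x_2-y_2|}+e^{-\kappa(x_2+y_2)}\sigma_{22}(i\kappa)\end{bmatrix}$$ maps $C$ into $C$ for all $\kappa>0$ and all $x_1,x_2,y_1,y_2\in[0,\infty)$, then $T(t)\,\mathcal C\subset\mathcal C$ for all $t\ge 0$. (2) If $\mathbb 1+\mathfrak S(i\kappa;A,B)$ maps $\{\xi\in\mathbb C^2 : |\xi_1|+|\xi_2|\le 1\}$ into itself for all $\kappa>0$, then the semigroup is $L^\infty$-contractive: for all $t\ge 0$ and all $f\in L^2([0,\infty))\oplus L^2([0,\infty))$, $$\|T(t)f\|_{L^\infty}\le\|f\|_{L^\infty},\qquad\text{where } \|f\|_{L^\infty}=\max_{i=1,2}\operatorname*{ess\,sup}_{x\ge 0}|f_i(x)|\in[0,\infty].$$ -/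

import Mathlib

open MeasureTheory Filter Topology Set
open scoped NNReal ENNReal Matrix ContDiff

noncomputable section

namespace PointInteraction

/-- Lebesgue measure on the half-line `[0,∞)`. -/
abbrev halfLine : Measure ℝ := volume.restrict (Ici (0 : ℝ))

/-- The Hilbert space `L²([0,∞);ℂ) ⊕ L²([0,∞);ℂ)`; its elements are `ψ = (ψ 0, ψ 1)`. -/
abbrev L2Sum : Type := PiLp 2 (fun _ : Fin 2 => Lp ℂ 2 halfLine)

/-- `v` is the weak (distributional) derivative of `u` on the open half-line `(0,∞)`, the test
functions being the smooth functions with compact support in `(0,∞)`. -/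
def IsWeakDeriv (u v : Lp ℂ 2 halfLine) : Prop :=
  ∀ φ : ℝ → ℂ, ContDiff ℝ ∞ φ → HasCompactSupport φ → tsupport φ ⊆ Ioi 0 →
    ∫ x, u x * deriv φ x ∂halfLine = -∫ x, v x * φ x ∂halfLine

/-- The representative of `u` that is continuous on `[0,∞)` exists and has the value `c` at `0`. -/
def HasBoundaryValue (u : Lp ℂ 2 halfLine) (c : ℂ) : Prop :=
  ∃ g : ℝ → ℂ, ContinuousOn g (Ici 0) ∧ u =ᵐ[halfLine] g ∧ g 0 = c

/-- The graph of the operator `Δ(A,B)`: this says that `ψ ∈ D(Δ(A,B))` and `Δ(A,B) ψ = χ`, that is,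
`ψ` lies in `H²([0,∞)) ⊕ H²([0,∞))` with first and second weak derivatives `dψ` and `χ` in `L²`, and
the boundary values `a = (ψ₁(0), ψ₂(0))` and `b = (ψ₁'(0), ψ₂'(0))` satisfy `A a + B b = 0`. -/
def IsLaplacian (A B : Matrix (Fin 2) (Fin 2) ℂ) (ψ χ : L2Sum) : Prop :=
  ∃ dψ : L2Sum,
    (∀ i, IsWeakDeriv (ψ i) (dψ i)) ∧ (∀ i, IsWeakDeriv (dψ i) (χ i)) ∧
    ∃ a b : Fin 2 → ℂ,
      (∀ i, HasBoundaryValue (ψ i) (a i)) ∧ (∀ i, HasBoundaryValue (dψ i) (b i)) ∧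
      A *ᵥ a + B *ᵥ b = 0

/-- Regular boundary conditions: `(A B)` has rank two and `A + ikB` is invertible for some
complex `k`. -/
def IsRegular (A B : Matrix (Fin 2) (Fin 2) ℂ) : Prop :=
  (Matrix.fromCols A B).rank = 2 ∧ ∃ k : ℂ, IsUnit (A + (Complex.I * k) • B)

/-- The Cayley transform `𝔖(k;A,B) = -(A + ikB)⁻¹ (A - ikB)`. -/
def cayley (A B : Matrix (Fin 2) (Fin 2) ℂ) (k : ℂ) : Matrix (Fin 2) (Fin 2) ℂ :=
  -((A + (Complex.I * k) • B)⁻¹ * (A - (Complex.I * k) • B))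

/-- A `C₀`-semigroup (strongly continuous one-parameter semigroup) of bounded linear operators. -/
structure C0Semigroup (X : Type*) [NormedAddCommGroup X] [NormedSpace ℂ X] where
  toFun : ℝ≥0 → X →L[ℂ] X
  map_zero : toFun 0 = ContinuousLinearMap.id ℂ X
  map_add : ∀ s t, toFun (s + t) = (toFun s).comp (toFun t)
  tendsto_zero : ∀ x, Tendsto (fun t => toFun t x) (𝓝 0) (𝓝 x)

/-- All operators of the semigroup have norm at most one. -/
def C0Semigroup.IsContractive {X : Type*} [NormedAddCommGroup X] [NormedSpace ℂ X]
    (T : C0Semigroup X) : Prop :=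
  ∀ t, ‖T.toFun t‖ ≤ 1

/-- The infinitesimal generator of `T` is the operator with graph `G`: `x` lies in the domain with
image `y` exactly when `(T(t)x - x)/t → y` as `t → 0+`. -/
def C0Semigroup.HasGenerator {X : Type*} [NormedAddCommGroup X] [NormedSpace ℂ X]
    (T : C0Semigroup X) (G : X → X → Prop) : Prop :=
  ∀ x y, G x y ↔
    Tendsto (fun t : ℝ≥0 => (((t : ℝ) : ℂ))⁻¹ • (T.toFun t x - x)) (𝓝[>] 0) (𝓝 y)

/-- The subset of `L² ⊕ L²` induced by `C ⊆ ℂ²`: all `f` with `(f₁(x), f₂(x)) ∈ C` for almost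
every `x`. -/
def inducedSet (C : Set (Fin 2 → ℂ)) : Set L2Sum :=
  {f | ∀ᵐ x ∂halfLine, (fun i => f i x) ∈ C}

/-- The kernel matrix of `κ² (κ² - Δ(A,B))⁻¹` at the points `x = (x₁, x₂)` and `y = (y₁, y₂)`. -/
def kernelMatrix (A B : Matrix (Fin 2) (Fin 2) ℂ) (κ : ℝ) (x y : Fin 2 → ℝ) :
    Matrix (Fin 2) (Fin 2) ℂ :=
  let σ := cayley A B (Complex.I * κ)
  let e : ℝ → ℂ := fun r => (Real.exp (-κ * r) : ℝ)
  ((κ / 2 : ℝ) : ℂ) •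
    !![e |x 0 - y 0| + e (x 0 + y 0) * σ 0 0, e (x 0 + y 1) * σ 0 1;
       e (x 1 + y 0) * σ 1 0, e |x 1 - y 1| + e (x 1 + y 1) * σ 1 1]

/-- The matrix `M` leaves the set `C ⊆ ℂ²` invariant. -/
def LeavesInvariant (M : Matrix (Fin 2) (Fin 2) ℂ) (C : Set (Fin 2 → ℂ)) : Prop :=
  ∀ ξ ∈ C, M *ᵥ ξ ∈ C

/-- The norm of `L^∞` on the disjoint union of two half-lines (it may be `∞`). -/
def supNorm (f : L2Sum) : ℝ≥0∞ := ⨆ i, eLpNorm (f i) ∞ halfLine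

end PointInteraction

end

/-! Everything is read off the operators `l (l - Δ)⁻¹`. A closed set invariant under all of them is
invariant under `T(t)`, the strong limit of their `n`-th powers at `l = n / t`
(`C0Semigroup.HasGenerator.apply_mem`). Contractivity gives uniqueness for the resolvent equation;
existence comes from an explicit solution. For `l = κ²` the operator is the integral operator with
kernel `kernelMatrix` (`exists_isLaplacian_kernelMatrix`), since the Cayley transform is the
reflection coefficient that the boundary condition prescribes.

For (1), let `x = y → ∞` in the hypothesis: the matrix tends to `κ/2` times the identity, so a
nonempty `C` is a closed convex cone. Integrals of functions with values in such a cone stay in it,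
by Hahn–Banach (`integral_mem_of_cone`).

For (2), the test vectors `e_j` show that the entries of `1 + 𝔖` are at most one in modulus. The
kernel is then bounded in the maximum norm by `κ/2 (exp (-κ|x-y|) + exp (-κ(x+y)))`, whose integral
over `y` is exactly one. Hence every polydisc `{|ξ_i| ≤ M}` is invariant. -/

namespace PointInteraction

/-! ### Contraction semigroups and Euler's exponential formula. -/

namespace C0Semigroup

variable {X : Type*} [NormedAddCommGroup X] [NormedSpace ℂ X] {T : C0Semigroup X}
  {G : X → X → Prop}

lemma IsContractive.norm_apply_le (hT : T.IsContractive) (t : ℝ≥0) (x : X) :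
    ‖T.toFun t x‖ ≤ ‖x‖ := by
  simpa using (T.toFun t).le_of_opNorm_le (hT t) x

lemma HasGenerator.sub (hG : T.HasGenerator G) {x y x' y' : X} (h : G x y) (h' : G x' y') :
    G (x - x') (y - y') := by
  rw [hG] at h h' ⊢
  refine (h.sub h').congr fun t => ?_
  rw [map_sub, ← smul_sub]
  congr 1
  abel

lemma HasGenerator.smul (hG : T.HasGenerator G) (c : ℂ) {x y : X} (h : G x y) :
    G (c • x) (c • y) := by
  rw [hG] at h ⊢
  refine (h.const_smul c).congr fun t => ?_
  rw [map_smul, ← smul_sub, smul_comm]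

lemma HasGenerator.apply (hG : T.HasGenerator G) (s : ℝ≥0) {x y : X} (h : G x y) :
    G (T.toFun s x) (T.toFun s y) := by
  rw [hG] at h ⊢
  refine (((T.toFun s).continuous.tendsto y).comp h).congr fun t => ?_
  have h1 : T.toFun s (T.toFun t x) = T.toFun t (T.toFun s x) := by
    rw [← ContinuousLinearMap.comp_apply, ← ContinuousLinearMap.comp_apply, ← T.map_add,
      ← T.map_add, add_comm]
  simp only [Function.comp_apply, map_smul, map_sub, h1]

/-- Dissipativity: `(1 + c/t) x - (c/t) T(t) x` has norm at least `‖x‖` because `T(t)` is a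
contraction; let `t → 0`. -/
lemma HasGenerator.norm_le (hG : T.HasGenerator G) (hT : T.IsContractive) {x y : X}
    (h : G x y) {c : ℝ} (hc : 0 ≤ c) : ‖x‖ ≤ ‖x - (c : ℂ) • y‖ := by
  rw [hG] at h
  refine ge_of_tendsto ((tendsto_const_nhds.sub (h.const_smul (c : ℂ))).norm) ?_
  filter_upwards [self_mem_nhdsWithin] with t ht
  have ht : (0 : ℝ) < t := NNReal.coe_pos.2 ht
  have hct : 0 ≤ c * (t : ℝ)⁻¹ := by positivity
  have e : x - (c : ℂ) • (((t : ℝ) : ℂ))⁻¹ • (T.toFun t x - x)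
      = ((1 + c * (t : ℝ)⁻¹ : ℝ) : ℂ) • x - ((c * (t : ℝ)⁻¹ : ℝ) : ℂ) • T.toFun t x := by
    push_cast
    module
  have h1 := norm_sub_norm_le (((1 + c * (t : ℝ)⁻¹ : ℝ) : ℂ) • x)
    (((c * (t : ℝ)⁻¹ : ℝ) : ℂ) • T.toFun t x)
  rw [← e, norm_smul, norm_smul, Complex.norm_real, Complex.norm_real, Real.norm_of_nonneg hct,
    Real.norm_of_nonneg (by positivity)] at h1
  have h2 := mul_le_mul_of_nonneg_left (hT.norm_apply_le t x) hct
  linarith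

/-- The relation `G u (l • (u - f))` stands for `u = l (l - G)⁻¹ f`, so no resolvent operator has to
be constructed. -/
lemma HasGenerator.resolvent_norm_sub_le (hG : T.HasGenerator G) (hT : T.IsContractive) {l : ℝ}
    (hl : 0 < l) {u f v g : X} (hu : G u ((l : ℂ) • (u - f))) (hv : G v ((l : ℂ) • (v - g))) :
    ‖u - v‖ ≤ ‖f - g‖ := by
  have h := hG.norm_le hT (hG.sub hu hv) (inv_pos.2 hl).le
  have e : u - v - ((l⁻¹ : ℝ) : ℂ) • ((l : ℂ) • (u - f) - (l : ℂ) • (v - g)) = f - g := by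
    have : (l : ℂ) ≠ 0 := by exact_mod_cast hl.ne'
    rw [← smul_sub, smul_smul, Complex.ofReal_inv, inv_mul_cancel₀ this]
    module
  rwa [e] at h

lemma HasGenerator.resolvent_unique (hG : T.HasGenerator G) (hT : T.IsContractive) {l : ℝ}
    (hl : 0 < l) {u v f : X} (hu : G u ((l : ℂ) • (u - f))) (hv : G v ((l : ℂ) • (v - f))) :
    u = v := by
  have := hG.resolvent_norm_sub_le hT hl hu hv
  rw [sub_self, norm_zero] at this
  exact sub_eq_zero.1 (norm_le_zero_iff.1 this)

lemma IsContractive.continuous_apply (hT : T.IsContractive) (x : X) :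
    Continuous fun t => T.toFun t x := by
  have key : ∀ s r : ℝ≥0, s ≤ r → ‖T.toFun r x - T.toFun s x‖ ≤ ‖T.toFun (r - s) x - x‖ := by
    intro s r hsr
    have : T.toFun r x = T.toFun s (T.toFun (r - s) x) := by
      rw [← ContinuousLinearMap.comp_apply, ← T.map_add, add_tsub_cancel_of_le hsr]
    rw [this, ← map_sub]
    exact hT.norm_apply_le _ _
  refine continuous_iff_continuousAt.2 fun s => ?_
  refine tendsto_iff_norm_sub_tendsto_zero.2 ?_
  have h0 : Tendsto (fun t => ‖T.toFun t x - x‖) (𝓝 0) (𝓝 0) :=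
    tendsto_iff_norm_sub_tendsto_zero.1 (T.tendsto_zero x)
  have h1 : Tendsto (fun t : ℝ≥0 => nndist t s) (𝓝 s) (𝓝 0) := by
    have : Continuous fun t : ℝ≥0 => nndist t s := by fun_prop
    simpa using this.tendsto s
  refine squeeze_zero (fun _ => norm_nonneg _) (fun t => ?_) (h0.comp h1)
  simp only [Function.comp_apply, NNReal.nndist_eq]
  rcases le_total s t with h | h
  · rw [tsub_eq_zero_of_le h, max_eq_left zero_le]
    exact key s t h
  · rw [tsub_eq_zero_of_le h, max_eq_right zero_le, norm_sub_rev]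
    exact key t s h

/-- The domain of the generator is dense. -/
lemma HasGenerator.exists_norm_sub_lt [CompleteSpace X] (hG : T.HasGenerator G)
    (hT : T.IsContractive) (f : X) {ε : ℝ} (hε : 0 < ε) : ∃ x y, G x y ∧ ‖f - x‖ < ε := by
  set S : ℝ → X := fun s => T.toFun s.toNNReal f with hS
  have hSc : Continuous S := (hT.continuous_apply f).comp continuous_real_toNNReal
  set F : ℝ → X := fun t => ∫ s in (0 : ℝ)..t, S s with hF
  have hFd : ∀ t, HasDerivAt F (S t) t := fun t => hSc.integral_hasStrictDerivAt 0 t |>.hasDerivAt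
  have hF0 : F 0 = 0 := by simp [hF]
  have hS0 : S 0 = f := by simp [hS, T.map_zero]
  have hpos : Tendsto (fun h : ℝ≥0 => (h : ℝ)) (𝓝[>] 0) (𝓝[>] 0) := by
    refine tendsto_nhdsWithin_iff.2 ⟨?_, ?_⟩
    · exact (NNReal.continuous_coe.tendsto' 0 0 rfl).mono_left nhdsWithin_le_nhds
    · filter_upwards [self_mem_nhdsWithin] with h hh
      exact NNReal.coe_pos.2 hh
  have hquot : ∀ t, Tendsto (fun h : ℝ≥0 => (((h : ℝ) : ℂ))⁻¹ • (F (t + h) - F t)) (𝓝[>] 0)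
      (𝓝 (S t)) := by
    intro t
    refine ((hFd t).tendsto_slope_zero_right.comp hpos).congr fun h => ?_
    simp only [Function.comp_apply]
    rw [← Complex.ofReal_inv, Complex.coe_smul]
  -- Orbit integrals lie in the domain: `T(h)` moves the window `[0, t]` to `[h, t + h]`, and only
  -- the two ends contribute to the difference quotient. The averages `F h / h` tend to `f`.
  have hGF : ∀ t, 0 ≤ t → G (F t) (S t - f) := by
    intro t ht
    rw [hG]
    have h1 := (hquot t).sub (hquot 0)
    rw [hS0] at h1
    refine h1.congr fun h => ?_
    rw [← smul_sub]
    congr 1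
    have h2 : T.toFun h (F t) = F (t + h) - F h := by
      have : ∀ s ∈ uIcc 0 t, T.toFun h (S s) = S (s + h) := by
        intro s hs
        rw [uIcc_of_le ht] at hs
        simp only [hS]
        rw [← ContinuousLinearMap.comp_apply, ← T.map_add, Real.toNNReal_add hs.1 h.coe_nonneg,
          Real.toNNReal_coe, add_comm]
      simp only [hF]
      rw [← ContinuousLinearMap.intervalIntegral_comp_comm _ (hSc.intervalIntegrable _ _),
        intervalIntegral.integral_congr this, intervalIntegral.integral_comp_add_right, zero_add,
        intervalIntegral.integral_interval_sub_left (hSc.intervalIntegrable _ _)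
          (hSc.intervalIntegrable _ _)]
    rw [h2, zero_add, hF0]
    abel
  have h3 : Tendsto (fun h : ℝ≥0 => ‖f - (((h : ℝ) : ℂ))⁻¹ • F h‖) (𝓝[>] 0) (𝓝 0) := by
    have := (tendsto_const_nhds (x := f)).sub (hquot 0)
    simpa [hS0, hF0] using this.norm
  obtain ⟨h, hh, -⟩ := ((h3.eventually (gt_mem_nhds hε)).and self_mem_nhdsWithin).exists
  exact ⟨_, _, hG.smul _ (hGF h h.2), hh⟩

/-- A resolvent step approximates the identity. -/
lemma HasGenerator.eventually_norm_resolvent_sub_le [CompleteSpace X] (hG : T.HasGenerator G)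
    (hT : T.IsContractive) (g : X) {ε : ℝ} (hε : 0 < ε) :
    ∃ δ > 0, ∀ h : ℝ, 0 < h → h < δ → ∀ u, G u (((h⁻¹ : ℝ) : ℂ) • (u - g)) → ‖u - g‖ ≤ ε := by
  obtain ⟨x, y, hxy, hx⟩ := hG.exists_norm_sub_lt hT g (ε := ε / 3) (by positivity)
  refine ⟨ε / 3 / (‖y‖ + 1), by positivity, fun h hh hd u hu => ?_⟩
  have hh' : (h : ℂ) ≠ 0 := by exact_mod_cast hh.ne'
  -- On the domain the resolvent is explicit: it sends `x - h y` to `x`.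
  have h1 : G x (((h⁻¹ : ℝ) : ℂ) • (x - (x - (h : ℂ) • y))) := by
    rwa [sub_sub_cancel, smul_smul, Complex.ofReal_inv, inv_mul_cancel₀ hh', one_smul]
  have h2 := hG.resolvent_norm_sub_le hT (inv_pos.2 hh) hu h1
  have h3 : ‖g - (x - (h : ℂ) • y)‖ ≤ ‖g - x‖ + h * ‖y‖ := by
    rw [← sub_add]
    refine (norm_add_le _ _).trans_eq ?_
    rw [norm_smul, Complex.norm_real, Real.norm_of_nonneg hh.le]
  have h4 : h * ‖y‖ ≤ ε / 3 := by
    rw [lt_div_iff₀ (by positivity)] at hd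
    nlinarith [norm_nonneg y]
  have h5 : ‖u - g‖ ≤ ‖u - x‖ + ‖g - x‖ := by
    rw [norm_sub_rev g x]
    simpa using norm_add_le (u - x) (x - g)
  linarith

/-- A resolvent step approximates the semigroup to first order on the domain of the generator. -/
lemma HasGenerator.eventually_norm_apply_sub_resolvent_le [CompleteSpace X]
    (hG : T.HasGenerator G) (hT : T.IsContractive) {f g : X} (hfg : G f g) {ε : ℝ} (hε : 0 < ε) :
    ∃ δ > 0, ∀ h : ℝ≥0, 0 < h → (h : ℝ) < δ → ∀ u v, G u ((((h : ℝ)⁻¹ : ℝ) : ℂ) • (u - f)) →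
      G v ((((h : ℝ)⁻¹ : ℝ) : ℂ) • (v - g)) → ‖T.toFun h f - u‖ ≤ h * ε := by
  obtain ⟨δ₁, hδ₁, H₁⟩ := hG.eventually_norm_resolvent_sub_le hT g (ε := ε / 2) (by positivity)
  have h0 := tendsto_iff_norm_sub_tendsto_zero.1 ((hG f g).1 hfg)
  have h0 := h0.eventually (gt_mem_nhds (half_pos hε))
  rw [eventually_nhdsWithin_iff, Metric.eventually_nhds_iff] at h0
  obtain ⟨δ₂, hδ₂, H₂⟩ := h0
  refine ⟨min δ₁ δ₂, lt_min hδ₁ hδ₂, fun h hh hd u v hu hv => ?_⟩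
  have hh0 : (0 : ℝ) < h := NNReal.coe_pos.2 hh
  have hh' : ((h : ℝ) : ℂ) ≠ 0 := by exact_mod_cast hh0.ne'
  have a1 := H₁ h hh0 (hd.trans_le (min_le_left _ _)) v hv
  have a2 := H₂ (y := h) (by
    rw [NNReal.dist_eq, NNReal.coe_zero, sub_zero, abs_of_pos hh0]
    exact hd.trans_le (min_le_right _ _)) hh
  -- The resolvent commutes with the generator: both sides solve the resolvent equation with datum
  -- `h g`.
  have a3 : u - f = ((h : ℝ) : ℂ) • v := by
    refine hG.resolvent_unique hT (inv_pos.2 hh0) (f := ((h : ℝ) : ℂ) • g) ?_ ?_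
    · convert! hG.sub hu hfg using 1
      rw [smul_sub, smul_smul, Complex.ofReal_inv, inv_mul_cancel₀ hh', one_smul]
    · convert! hG.smul ((h : ℝ) : ℂ) hv using 1
      rw [← smul_sub, smul_comm]
  have a4 : T.toFun h f - u = ((h : ℝ) : ℂ) • ((((h : ℝ) : ℂ)⁻¹ • (T.toFun h f - f) - g)
      - (v - g)) := by
    rw [sub_sub_sub_cancel_right, smul_sub, smul_smul, mul_inv_cancel₀ hh', one_smul, ← a3]
    abel
  rw [a4, norm_smul, Complex.norm_real, Real.norm_of_nonneg hh0.le]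
  refine mul_le_mul_of_nonneg_left ((norm_sub_le _ _).trans ?_) hh0.le
  linarith

/-- **Euler's exponential formula** as an invariance principle: a closed set that is invariant
under all the operators `l (l - Δ)⁻¹`, `l > 0`, is invariant under the semigroup. -/
theorem HasGenerator.apply_mem [CompleteSpace X] (hG : T.HasGenerator G) (hT : T.IsContractive)
    {K : Set X} (hK : IsClosed K)
    (hR : ∀ l : ℝ, 0 < l → ∀ f, ∃ u, G u ((l : ℂ) • (u - f)) ∧ (f ∈ K → u ∈ K))
    (t : ℝ≥0) {f : X} (hf : f ∈ K) : T.toFun t f ∈ K := by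
  rcases eq_or_ne t 0 with rfl | ht
  · simpa [T.map_zero] using hf
  have ht0 : (0 : ℝ) < t := NNReal.coe_pos.2 (pos_iff_ne_zero.2 ht)
  refine hK.closure_subset (Metric.mem_closure_iff.2 fun ε hε => ?_)
  obtain ⟨x, y, hxy, hx⟩ := hG.exists_norm_sub_lt hT f (ε := ε / 4) (by positivity)
  -- With `n` steps of length `h = t/n`, an error of `h * (ε / 4 / t)` per step adds up to `ε / 4`.
  obtain ⟨δ, hδ, H⟩ := hG.eventually_norm_apply_sub_resolvent_le hT hxy (ε := ε / 4 / t)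
    (by positivity)
  obtain ⟨n, hn⟩ := exists_nat_gt ((t : ℝ) / δ)
  have hn0 : (0 : ℝ) < n := (div_pos ht0 hδ).trans hn
  set h : ℝ≥0 := t / n with hh
  have hcoe : (h : ℝ) = t / n := by simp [hh]
  have hh0 : (0 : ℝ) < h := by rw [hcoe]; positivity
  have hhδ : (h : ℝ) < δ := by
    rw [hcoe, div_lt_iff₀ hn0, mul_comm]
    exact (div_lt_iff₀ hδ).1 hn
  choose R hRG hRK using hR (h : ℝ)⁻¹ (inv_pos.2 hh0)
  have hRT : ∀ s z, R (T.toFun s z) = T.toFun s (R z) := fun s z => by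
    refine hG.resolvent_unique hT (inv_pos.2 hh0) (hRG _) ?_
    convert! hG.apply s (hRG z) using 1
    rw [map_smul, map_sub]
  have hRn : ∀ (m : ℕ) (z w : X), ‖R^[m] z - R^[m] w‖ ≤ ‖z - w‖ := by
    intro m
    induction m with
    | zero => simp
    | succ m ih =>
      intro z w
      rw [Function.iterate_succ_apply, Function.iterate_succ_apply]
      exact (ih _ _).trans (hG.resolvent_norm_sub_le hT (inv_pos.2 hh0) (hRG _) (hRG _))
  have hRKn : ∀ m : ℕ, R^[m] f ∈ K := by
    intro m
    induction m with
    | zero => simpa using hf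
    | succ m ih =>
      rw [Function.iterate_succ_apply']
      exact hRK _ ih
  have hstep := H h (NNReal.coe_pos.1 hh0) hhδ (R x) (R y) (hRG x) (hRG y)
  -- Telescoping: `R` commutes with the semigroup and both are nonexpansive, so the one-step errors
  -- just add.
  have htel : ∀ m : ℕ, ‖T.toFun (m * h) x - R^[m] x‖ ≤ m * ‖T.toFun h x - R x‖ := by
    intro m
    induction m with
    | zero => simp [T.map_zero]
    | succ m ih =>
      have e1 : T.toFun ((m + 1 : ℕ) * h) x - R^[m + 1] x
          = T.toFun (m * h) (T.toFun h x - R x) + (R (T.toFun (m * h) x) - R (R^[m] x)) := by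
        rw [Function.iterate_succ_apply', hRT, map_sub, Nat.cast_succ, add_mul, one_mul, T.map_add,
          ContinuousLinearMap.comp_apply]
        abel
      rw [e1]
      have e2 := norm_add_le (T.toFun (m * h) (T.toFun h x - R x))
        (R (T.toFun (m * h) x) - R (R^[m] x))
      have e3 := hT.norm_apply_le (m * h) (T.toFun h x - R x)
      have e4 := hRn 1 (T.toFun (m * h) x) (R^[m] x)
      simp only [Function.iterate_one] at e4
      push_cast
      linarith
  refine ⟨R^[n] f, hRKn n, ?_⟩
  have hnt : (n : ℝ≥0) * h = t := by
    have : (n : ℝ≥0) ≠ 0 := by exact_mod_cast hn0.ne'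
    rw [hh, mul_div_cancel₀ _ this]
  have b1 := htel n
  rw [hnt] at b1
  have b2 : (n : ℝ) * ‖T.toFun h x - R x‖ ≤ ε / 4 := by
    calc (n : ℝ) * ‖T.toFun h x - R x‖ ≤ n * (h * (ε / 4 / t)) := by gcongr
      _ = ε / 4 := by rw [hcoe]; field_simp
  have b3 := hT.norm_apply_le t (f - x)
  have b4 := hRn n x f
  rw [norm_sub_rev x f] at b4
  rw [dist_eq_norm]
  have e : T.toFun t f - R^[n] f = T.toFun t (f - x) + (T.toFun t x - R^[n] x)
      + (R^[n] x - R^[n] f) := by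
    rw [map_sub]
    abel
  rw [e]
  have b5 := norm_add₃_le (a := T.toFun t (f - x)) (b := T.toFun t x - R^[n] x)
    (c := R^[n] x - R^[n] f)
  linarith

end C0Semigroup

end PointInteraction

noncomputable section

namespace PointInteraction

/-! ### The exponential kernel on the half-line -/

lemma integrable_exp_halfLine {κ : ℝ} (hκ : 0 < κ) :
    Integrable (fun y => Real.exp (-κ * y)) halfLine :=
  (integrableOn_Ici_iff_integrableOn_Ioi).2 (integrableOn_exp_mul_Ioi (neg_lt_zero.2 hκ) 0)

lemma integral_exp_halfLine {κ : ℝ} (hκ : 0 < κ) :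
    ∫ y, Real.exp (-κ * y) ∂halfLine = κ⁻¹ := by
  rw [integral_Ici_eq_integral_Ioi, integral_exp_mul_Ioi (neg_lt_zero.2 hκ)]
  simp

lemma memLp_exp_halfLine {κ : ℝ} (hκ : 0 < κ) :
    MemLp (fun y => Real.exp (-κ * y)) 2 halfLine := by
  rw [memLp_two_iff_integrable_sq (by fun_prop)]
  refine (integrable_exp_halfLine (κ := 2 * κ) (by positivity)).congr (ae_of_all _ fun y => ?_)
  simp only [← Real.exp_nat_mul]
  congr 1
  push_cast
  ring

/-- For fixed `x` this dominates the kernel by a multiple of `exp (-κ y)`, which is integrable and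
square integrable. -/
lemma exp_abs_sub_le {κ : ℝ} (hκ : 0 < κ) (x y : ℝ) :
    Real.exp (-κ * |x - y|) ≤ Real.exp (κ * x) * Real.exp (-κ * y) := by
  rw [← Real.exp_add, Real.exp_le_exp]
  nlinarith [neg_abs_le (x - y)]

lemma integrable_exp_abs_halfLine {κ : ℝ} (hκ : 0 < κ) (x : ℝ) :
    Integrable (fun y => Real.exp (-κ * |x - y|)) halfLine := by
  refine ((integrable_exp_halfLine hκ).const_mul (Real.exp (κ * x))).mono' (by fun_prop)
    (ae_of_all _ fun y => ?_)
  rw [Real.norm_of_nonneg (Real.exp_nonneg _)]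
  exact exp_abs_sub_le hκ x y

lemma halfLine_eq_add {x : ℝ} (hx : 0 ≤ x) :
    halfLine = volume.restrict (Ioc 0 x) + volume.restrict (Ioi x) := by
  rw [← Measure.restrict_union (by simp [Set.disjoint_left]) measurableSet_Ioi,
    Ioc_union_Ioi_eq_Ioi hx]
  exact restrict_Ioi_eq_restrict_Ici.symm

lemma integral_exp_abs_halfLine {κ : ℝ} (hκ : 0 < κ) {x : ℝ} (hx : 0 ≤ x) :
    ∫ y, Real.exp (-κ * |x - y|) ∂halfLine = (2 - Real.exp (-κ * x)) * κ⁻¹ := by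
  have hi := integrable_exp_abs_halfLine hκ x
  rw [halfLine_eq_add hx] at hi ⊢
  rw [integral_add_measure hi.left_of_add_measure hi.right_of_add_measure]
  have h1 : ∫ y in Ioc 0 x, Real.exp (-κ * |x - y|) = (1 - Real.exp (-κ * x)) * κ⁻¹ := by
    have : ∀ y ∈ Ioc 0 x, Real.exp (-κ * |x - y|) = Real.exp (-κ * x) * Real.exp (κ * y) := by
      intro y hy
      rw [abs_of_nonneg (sub_nonneg.2 hy.2), ← Real.exp_add]
      ring_nf
    rw [setIntegral_congr_fun measurableSet_Ioc this, ← intervalIntegral.integral_of_le hx,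
      intervalIntegral.integral_const_mul, intervalIntegral.integral_comp_mul_left _ hκ.ne',
      integral_exp]
    have e : Real.exp (-κ * x) * Real.exp (κ * x) = 1 := by
      rw [← Real.exp_add]
      simp
    simp only [smul_eq_mul, mul_zero, Real.exp_zero]
    linear_combination κ⁻¹ * e
  have h2 : ∫ y in Ioi x, Real.exp (-κ * |x - y|) = κ⁻¹ := by
    have : ∀ y ∈ Ioi x, Real.exp (-κ * |x - y|) = Real.exp (κ * x) * Real.exp (-κ * y) := by
      intro y hy
      rw [abs_of_neg (sub_neg.2 hy), ← Real.exp_add]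
      ring_nf
    rw [setIntegral_congr_fun measurableSet_Ioi this, integral_const_mul,
      integral_exp_mul_Ioi (neg_lt_zero.2 hκ)]
    have e : Real.exp (κ * x) * Real.exp (-κ * x) = 1 := by
      rw [← Real.exp_add]
      simp
    rw [neg_div_neg_eq, div_eq_mul_inv, ← mul_assoc, e, one_mul]
  rw [h1, h2]
  ring

lemma lintegral_exp_abs_halfLine_le {κ : ℝ} (hκ : 0 < κ) {x : ℝ} (hx : 0 ≤ x) :
    ∫⁻ y, ENNReal.ofReal (Real.exp (-κ * |x - y|)) ∂halfLine ≤ ENNReal.ofReal (2 * κ⁻¹) := by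
  rw [← ofReal_integral_eq_lintegral_ofReal (integrable_exp_abs_halfLine hκ x)
    (ae_of_all _ fun y => Real.exp_nonneg _), integral_exp_abs_halfLine hκ hx]
  refine ENNReal.ofReal_le_ofReal (mul_le_mul_of_nonneg_right ?_ (inv_pos.2 hκ).le)
  linarith [Real.exp_pos (-κ * x)]

/-- **Schur's test** for an integral operator with symmetric kernel. -/
lemma lintegral_sq_lintegral_mul_le {α : Type*} [MeasurableSpace α] {μ : Measure α} [SFinite μ]
    {k : α → α → ℝ≥0∞} (hk : Measurable (Function.uncurry k)) (hs : ∀ x y, k x y = k y x)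
    {c : ℝ≥0∞} (hc : ∀ᵐ x ∂μ, ∫⁻ y, k x y ∂μ ≤ c) {g : α → ℝ≥0∞} (hg : AEMeasurable g μ) :
    ∫⁻ x, (∫⁻ y, k x y * g y ∂μ) ^ (2 : ℝ) ∂μ ≤ c * (c * ∫⁻ y, g y ^ (2 : ℝ) ∂μ) := by
  have hk1 : ∀ x, Measurable (k x) := fun x => hk.comp measurable_prodMk_left
  -- Cauchy–Schwarz for the factorization `k g = k^(1/2) (k g²)^(1/2)`.
  have h1 : ∀ x, (∫⁻ y, k x y * g y ∂μ) ^ (2 : ℝ)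
      ≤ (∫⁻ y, k x y ∂μ) * ∫⁻ y, k x y * g y ^ (2 : ℝ) ∂μ := by
    intro x
    have h := ENNReal.lintegral_mul_norm_pow_le (hk1 x).aemeasurable
      ((hk1 x).aemeasurable.mul (hg.pow_const (2 : ℝ))) (p := 1 / 2) (q := 1 / 2) (by norm_num)
      (by norm_num) (by norm_num)
    have e : ∀ y, k x y ^ (1 / 2 : ℝ) * (k x y * g y ^ (2 : ℝ)) ^ (1 / 2 : ℝ) = k x y * g y := by
      intro y
      rw [ENNReal.mul_rpow_of_nonneg _ _ (by norm_num), ← mul_assoc,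
        ← ENNReal.rpow_add_of_nonneg _ _ (by norm_num) (by norm_num), ← ENNReal.rpow_mul]
      norm_num
    simp only [Pi.mul_apply, e] at h
    refine (ENNReal.rpow_le_rpow h (by norm_num)).trans_eq ?_
    rw [← ENNReal.mul_rpow_of_nonneg _ _ (by norm_num), ← ENNReal.rpow_mul]
    norm_num
  calc ∫⁻ x, (∫⁻ y, k x y * g y ∂μ) ^ (2 : ℝ) ∂μ
      ≤ ∫⁻ x, c * ∫⁻ y, k x y * g y ^ (2 : ℝ) ∂μ ∂μ :=
        lintegral_mono_ae (hc.mono fun x hx => (h1 x).trans (mul_le_mul_left hx _))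
    _ = c * ∫⁻ x, ∫⁻ y, k x y * g y ^ (2 : ℝ) ∂μ ∂μ := by
        refine lintegral_const_mul'' _ ?_
        exact (hk.aemeasurable.mul
          (hg.pow_const (2 : ℝ)).comp_snd).lintegral_prod_right'
    _ = c * ∫⁻ y, ∫⁻ x, k x y * g y ^ (2 : ℝ) ∂μ ∂μ := by
        rw [lintegral_lintegral_swap (hk.aemeasurable.mul (hg.pow_const (2 : ℝ)).comp_snd)]
    _ ≤ c * ∫⁻ y, c * g y ^ (2 : ℝ) ∂μ := by
        refine mul_le_mul_right (lintegral_mono_ae (hc.mono fun y hy => ?_)) _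
        simp only [hs _ y]
        rw [lintegral_mul_const _ (hk1 y)]
        exact mul_le_mul_left hy _
    _ = c * (c * ∫⁻ y, g y ^ (2 : ℝ) ∂μ) := by rw [lintegral_const_mul'' _ (hg.pow_const (2 : ℝ))]

variable {κ : ℝ} {f : ℝ → ℂ}

lemma integrable_exp_mul_halfLine (hκ : 0 < κ) (hf : MemLp f 2 halfLine) :
    Integrable (fun y => ((Real.exp (-κ * y) : ℝ) : ℂ) * f y) halfLine :=
  ((memLp_exp_halfLine hκ).ofReal (K := ℂ)).integrable_mul hf

lemma integrable_exp_abs_mul_halfLine (hκ : 0 < κ) (hf : MemLp f 2 halfLine) (x : ℝ) :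
    Integrable (fun y => ((Real.exp (-κ * |x - y|) : ℝ) : ℂ) * f y) halfLine := by
  refine ((integrable_exp_mul_halfLine hκ hf).norm.const_mul (Real.exp (κ * x))).mono'
    ((by fun_prop : Continuous fun y =>
      ((Real.exp (-κ * |x - y|) : ℝ) : ℂ)).aestronglyMeasurable.mul hf.aestronglyMeasurable)
    (ae_of_all _ fun y => ?_)
  rw [norm_mul, norm_mul, Complex.norm_real, Complex.norm_real,
    Real.norm_of_nonneg (Real.exp_nonneg _), Real.norm_of_nonneg (Real.exp_nonneg _), ← mul_assoc]
  exact mul_le_mul_of_nonneg_right (exp_abs_sub_le hκ x y) (norm_nonneg _)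

/-- Schur's test, the row integrals of the symmetric kernel being at most `2/κ`. -/
lemma memLp_integral_exp_abs_mul (hκ : 0 < κ) (hf : MemLp f 2 halfLine) :
    MemLp (fun x => ∫ y, Real.exp (-κ * |x - y|) * ‖f y‖ ∂halfLine) 2 halfLine := by
  have hm : AEStronglyMeasurable
      (fun x => ∫ y, Real.exp (-κ * |x - y|) * ‖f y‖ ∂halfLine) halfLine := by
    have : AEStronglyMeasurable (fun p : ℝ × ℝ => Real.exp (-κ * |p.1 - p.2|) * ‖f p.2‖)
        (halfLine.prod halfLine) :=
      (by fun_prop : Continuous fun p : ℝ × ℝ =>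
        Real.exp (-κ * |p.1 - p.2|)).aestronglyMeasurable.mul hf.aestronglyMeasurable.norm.comp_snd
    exact this.integral_prod_right'
  refine ⟨hm, ?_⟩
  rw [eLpNorm_lt_top_iff_lintegral_rpow_enorm_lt_top (by norm_num) (by norm_num)]
  have hf2 := (eLpNorm_lt_top_iff_lintegral_rpow_enorm_lt_top (by norm_num) (by norm_num)).1
    hf.eLpNorm_lt_top
  simp only [ENNReal.toReal_ofNat] at hf2 ⊢
  refine lt_of_le_of_lt ?_ (ENNReal.mul_lt_top
    (ENNReal.ofReal_lt_top (r := 2 * κ⁻¹)) (ENNReal.mul_lt_top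
    (ENNReal.ofReal_lt_top (r := 2 * κ⁻¹)) hf2))
  refine le_trans (lintegral_mono fun x => ENNReal.rpow_le_rpow
    (enorm_integral_le_lintegral_enorm _) (by norm_num)) ?_
  simp only [enorm_mul, enorm_norm, Real.enorm_eq_ofReal (Real.exp_nonneg _)]
  refine lintegral_sq_lintegral_mul_le (k := fun x y => ENNReal.ofReal (Real.exp (-κ * |x - y|)))
    (by fun_prop) (fun x y => by rw [abs_sub_comm]) ?_ hf.aestronglyMeasurable.enorm
  exact (ae_restrict_mem measurableSet_Ici).mono fun x hx => lintegral_exp_abs_halfLine_le hκ hx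

/-! ### Weak derivatives -/

/-- Fubini on the triangle `y ≤ x`; thus `g` need only be integrable, and its primitive need not be
differentiable everywhere. -/
lemma integral_primitive_mul {g ψ ψ' : ℝ → ℂ} {R : ℝ}
    (hg : IntegrableOn g (Ioc 0 R)) (hψ : ∀ x, HasDerivAt ψ (ψ' x) x) (hψ' : Continuous ψ')
    (hψR : ψ R = 0) :
    ∫ x in Ioc 0 R, (∫ y in (0 : ℝ)..x, g y) * ψ' x = -∫ x in Ioc 0 R, g x * ψ x := by
  set μ : Measure ℝ := volume.restrict (Ioc 0 R) with hμ
  have hD : MeasurableSet {p : ℝ × ℝ | p.2 ≤ p.1} := measurableSet_le measurable_snd measurable_fst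
  have hint : Integrable (Function.uncurry fun x y : ℝ =>
      {p : ℝ × ℝ | p.2 ≤ p.1}.indicator (fun p => ψ' p.1 * g p.2) (x, y)) (μ.prod μ) := by
    have h1 : Integrable ψ' μ := (hψ'.integrableOn_Icc (a := 0) (b := R)).mono_set
      Ioc_subset_Icc_self
    exact (h1.mul_prod hg).indicator hD
  have hswap := integral_integral_swap hint
  have hL : ∀ x ∈ Ioc 0 R, ∫ y, {p : ℝ × ℝ | p.2 ≤ p.1}.indicator
      (fun p => ψ' p.1 * g p.2) (x, y) ∂μ = (∫ y in (0 : ℝ)..x, g y) * ψ' x := by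
    intro x hx
    have : ∀ y, {p : ℝ × ℝ | p.2 ≤ p.1}.indicator (fun p => ψ' p.1 * g p.2) (x, y)
        = (Iic x).indicator (fun y => ψ' x * g y) y := fun y => by
      simp [indicator_apply]
    simp only [this]
    rw [integral_indicator measurableSet_Iic, hμ, Measure.restrict_restrict measurableSet_Iic,
      integral_const_mul, mul_comm, intervalIntegral.integral_of_le hx.1.le, inter_comm,
      Ioc_inter_Iic, min_eq_right hx.2]
  have hRt : ∀ y ∈ Ioc 0 R, ∫ x, {p : ℝ × ℝ | p.2 ≤ p.1}.indicator
      (fun p => ψ' p.1 * g p.2) (x, y) ∂μ = -(g y * ψ y) := by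
    intro y hy
    have : ∀ x, {p : ℝ × ℝ | p.2 ≤ p.1}.indicator (fun p => ψ' p.1 * g p.2) (x, y)
        = (Ici y).indicator (fun x => ψ' x * g y) x := fun x => by
      simp [indicator_apply]
    simp only [this]
    have hset : Ici y ∩ Ioc 0 R = Icc y R := by
      ext z
      simp only [mem_inter_iff, mem_Ici, mem_Ioc, mem_Icc]
      exact ⟨fun h => ⟨h.1, h.2.2⟩, fun h => ⟨h.1, hy.1.trans_le h.1, h.2⟩⟩
    rw [integral_indicator measurableSet_Ici, hμ, Measure.restrict_restrict measurableSet_Ici,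
      hset, integral_mul_const, integral_Icc_eq_integral_Ioc, ← intervalIntegral.integral_of_le hy.2,
      intervalIntegral.integral_eq_sub_of_hasDerivAt (fun x _ => hψ x) (hψ'.intervalIntegrable _ _),
      hψR]
    ring
  rw [setIntegral_congr_fun measurableSet_Ioc hL, setIntegral_congr_fun measurableSet_Ioc hRt,
    integral_neg] at hswap
  exact hswap

/-- The weak derivative of `a P`, where `a` is of class `C¹` and `P` is a primitive of `p`. -/
lemma integral_mul_primitive_mul_deriv {a a' p φ : ℝ → ℂ} (P₀ : ℂ)
    (ha : ∀ x, HasDerivAt a (a' x) x) (ha' : Continuous a')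
    (hp : ∀ R, 0 ≤ R → IntegrableOn p (Ioc 0 R)) (hφ : ContDiff ℝ ∞ φ)
    (hφc : HasCompactSupport φ) (hφ0 : tsupport φ ⊆ Ioi 0) :
    Integrable (fun x => a x * (P₀ + ∫ y in (0 : ℝ)..x, p y) * deriv φ x) halfLine ∧
    Integrable (fun x => (a' x * (P₀ + ∫ y in (0 : ℝ)..x, p y) + a x * p x) * φ x) halfLine ∧
    ∫ x, a x * (P₀ + ∫ y in (0 : ℝ)..x, p y) * deriv φ x ∂halfLine
      = -∫ x, (a' x * (P₀ + ∫ y in (0 : ℝ)..x, p y) + a x * p x) * φ x ∂halfLine := by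
  obtain ⟨R, hR0, hR⟩ : ∃ R, 0 ≤ R ∧ tsupport φ ⊆ Iio R := by
    obtain ⟨R, hR⟩ := hφc.isCompact.bddAbove
    exact ⟨max (R + 1) 0, le_max_right _ _, fun x hx =>
      (lt_of_le_of_lt (hR hx) (lt_add_one R)).trans_le (le_max_left _ _)⟩
  have hac : Continuous a := continuous_iff_continuousAt.2 fun x => (ha x).continuousAt
  have hφd : Continuous (deriv φ) := hφ.continuous_deriv (by simp)
  have hφz : ∀ x, x ∉ Ioc 0 R → φ x = 0 := fun x hx =>
    image_eq_zero_of_notMem_tsupport fun h => hx ⟨hφ0 h, (hR h).le⟩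
  have hφdz : ∀ x, x ∉ Ioc 0 R → deriv φ x = 0 := fun x hx =>
    image_eq_zero_of_notMem_tsupport fun h => by
      have := (closure_mono (support_deriv_subset (f := φ))) h
      rw [isClosed_tsupport φ |>.closure_eq] at this
      exact hx ⟨hφ0 this, (hR this).le⟩
  have hP : ContinuousOn (fun x => P₀ + ∫ y in (0 : ℝ)..x, p y) (Icc 0 R) := by
    refine continuousOn_const.add ?_
    have := intervalIntegral.continuousOn_primitive_interval (a := 0) (b := R) (f := p)
      (μ := volume) (by
        rw [uIcc_of_le hR0]
        exact (integrableOn_Icc_iff_integrableOn_Ioc).2 (hp R hR0))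
    rwa [uIcc_of_le hR0] at this
  have hpI : IntegrableOn p (Icc 0 R) := (integrableOn_Icc_iff_integrableOn_Ioc).2 (hp R hR0)
  have hsub : Ioc 0 R ⊆ Icc (0 : ℝ) R := Ioc_subset_Icc_self
  have hsub' : Ioc 0 R ⊆ Ici (0 : ℝ) := fun x hx => hx.1.le
  have i1 : IntegrableOn (fun x => a x * (P₀ + ∫ y in (0 : ℝ)..x, p y) * deriv φ x) (Ioc 0 R) :=
    (((hac.continuousOn.mul hP).mul hφd.continuousOn).integrableOn_Icc).mono_set hsub
  have i2 : IntegrableOn (fun x => a' x * (P₀ + ∫ y in (0 : ℝ)..x, p y) * φ x) (Ioc 0 R) :=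
    (((ha'.continuousOn.mul hP).mul hφ.continuous.continuousOn).integrableOn_Icc).mono_set hsub
  have i3 : IntegrableOn (fun x => p x * (a x * φ x)) (Ioc 0 R) :=
    (hpI.mul_continuousOn (hac.mul hφ.continuous).continuousOn isCompact_Icc).mono_set hsub
  have i4 : IntegrableOn (fun x => (a' x * (P₀ + ∫ y in (0 : ℝ)..x, p y) + a x * p x) * φ x)
      (Ioc 0 R) := (i2.add i3).congr_fun (fun x _ => by simp only [Pi.add_apply]; ring)
        measurableSet_Ioc
  have e : ∀ F : ℝ → ℂ, (∀ x, x ∉ Ioc 0 R → F x = 0) →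
      ∫ x, F x ∂halfLine = ∫ x in Ioc 0 R, F x := fun F hF =>
    setIntegral_eq_of_subset_of_forall_sdiff_eq_zero measurableSet_Ici hsub' fun x hx => hF x hx.2
  refine ⟨?_, ?_, ?_⟩
  · exact i1.of_forall_sdiff_eq_zero measurableSet_Ici fun x hx => by rw [hφdz x hx.2, mul_zero]
  · exact i4.of_forall_sdiff_eq_zero measurableSet_Ici fun x hx => by rw [hφz x hx.2, mul_zero]
  rw [e _ fun x hx => by rw [hφdz x hx, mul_zero], e _ fun x hx => by rw [hφz x hx, mul_zero]]
  have hψ : ∀ x, HasDerivAt (fun x => a x * φ x) (a' x * φ x + a x * deriv φ x) x := fun x =>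
    (ha x).mul (hφ.differentiable (by simp) x).hasDerivAt
  have hψ' : Continuous fun x => a' x * φ x + a x * deriv φ x :=
    (ha'.mul hφ.continuous).add (hac.mul hφd)
  have hφR : φ R = 0 := image_eq_zero_of_notMem_tsupport fun h => lt_irrefl R (hR h)
  have hφ00 : φ 0 = 0 := image_eq_zero_of_notMem_tsupport fun h => lt_irrefl (0 : ℝ) (hφ0 h)
  have m1 := integral_primitive_mul (hp R hR0) hψ hψ' (by simp [hφR])
  have m2 : ∫ x in Ioc 0 R, P₀ * (a' x * φ x + a x * deriv φ x) = 0 := by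
    rw [integral_const_mul, ← intervalIntegral.integral_of_le hR0,
      intervalIntegral.integral_eq_sub_of_hasDerivAt (fun x _ => hψ x)
        (hψ'.intervalIntegrable _ _), hφR, hφ00]
    simp
  -- The integrand regroups as `P (a φ)' + p (a φ)`. The constant part of `P` integrates to zero as
  -- `φ` vanishes at `0` and `R`; the rest cancels by `m1`.
  have m3 : ∫ x in Ioc 0 R, (a x * (P₀ + ∫ y in (0 : ℝ)..x, p y) * deriv φ x
      + (a' x * (P₀ + ∫ y in (0 : ℝ)..x, p y) + a x * p x) * φ x) = 0 := by
    have j1 : IntegrableOn (fun x => P₀ * (a' x * φ x + a x * deriv φ x)) (Ioc 0 R) :=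
      ((continuous_const.mul hψ').integrableOn_Icc).mono_set hsub
    have j2 : IntegrableOn (fun x => (∫ y in (0 : ℝ)..x, p y) *
        (a' x * φ x + a x * deriv φ x)) (Ioc 0 R) :=
      ((i1.add i2).sub j1).congr_fun (fun x _ => by simp only [Pi.add_apply, Pi.sub_apply]; ring)
        measurableSet_Ioc
    have : ∀ x, (a x * (P₀ + ∫ y in (0 : ℝ)..x, p y) * deriv φ x
        + (a' x * (P₀ + ∫ y in (0 : ℝ)..x, p y) + a x * p x) * φ x)
        = P₀ * (a' x * φ x + a x * deriv φ x) + ((∫ y in (0 : ℝ)..x, p y) *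
        (a' x * φ x + a x * deriv φ x) + p x * (a x * φ x)) := fun x => by ring
    simp only [this]
    have j3 : IntegrableOn (fun x => (∫ y in (0 : ℝ)..x, p y) *
        (a' x * φ x + a x * deriv φ x) + p x * (a x * φ x)) (Ioc 0 R) := j2.add i3
    rw [integral_add j1 j3, integral_add j2 i3, m1, m2]
    ring
  rw [integral_add i1 i4] at m3
  exact eq_neg_of_add_eq_zero_left m3

/-! ### Integrals with values in a convex cone -/

/-- A functional that separates the integral from the cone is nonnegative on the cone, hence on the
integral. As `μ` may be infinite, convexity alone would not do. -/
lemma integral_mem_of_cone {α E : Type*} [MeasurableSpace α] {μ : Measure α}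
    [NormedAddCommGroup E] [NormedSpace ℝ E] [CompleteSpace E] {C : Set E} (hC : IsClosed C)
    (hconv : Convex ℝ C) (h0 : (0 : E) ∈ C) (hcone : ∀ r : ℝ, 0 < r → ∀ c ∈ C, r • c ∈ C)
    {g : α → E} (hg : Integrable g μ) (hgC : ∀ᵐ x ∂μ, g x ∈ C) : ∫ x, g x ∂μ ∈ C := by
  by_contra hn
  obtain ⟨l, u, hu, hl⟩ := geometric_hahn_banach_point_closed hconv hC hn
  have hl0 : ∀ c ∈ C, 0 ≤ l c := by
    intro c hc
    by_contra! hlt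
    -- The factor is chosen so that `l` takes the value `u + l c < u` on the multiple of `c`.
    have h1 := hl _ (hcone (u / l c + 1) (by
      have : u < 0 := by simpa using hl 0 h0
      have := div_pos_of_neg_of_neg this hlt
      linarith) c hc)
    rw [map_smul, smul_eq_mul, add_mul, div_mul_cancel₀ _ hlt.ne] at h1
    linarith
  have h2 : 0 ≤ l (∫ x, g x ∂μ) := by
    rw [← l.integral_comp_comm hg]
    exact integral_nonneg_of_ae (hgC.mono fun x hx => hl0 _ hx)
  have h3 : u < 0 := by simpa using hl 0 h0
  linarith

end PointInteraction
end

noncomputable section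

namespace PointInteraction

/-! ### Solutions of `u'' = κ² (u - f)` on the half-line -/

/-- The coefficient of `exp (-κ x)` in the solution. -/
def decayCoeff (κ : ℝ) (f : ℝ → ℂ) (w : ℂ) (x : ℝ) : ℂ :=
  w + ∫ y in (0 : ℝ)..x, ((κ / 2 * Real.exp (κ * y) : ℝ) : ℂ) * f y

/-- The coefficient of `exp (κ x)` in the solution. -/
def growthCoeff (κ : ℝ) (f : ℝ → ℂ) (x : ℝ) : ℂ :=
  ((κ / 2 : ℝ) : ℂ) * (∫ y, ((Real.exp (-κ * y) : ℝ) : ℂ) * f y ∂halfLine) +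
    ∫ y in (0 : ℝ)..x, ((-(κ / 2) * Real.exp (-κ * y) : ℝ) : ℂ) * f y

/-- The square integrable solutions of `u'' = κ² (u - f)`. -/
def resolventFun (κ : ℝ) (f : ℝ → ℂ) (w : ℂ) (x : ℝ) : ℂ :=
  ((Real.exp (-κ * x) : ℝ) : ℂ) * decayCoeff κ f w x +
    ((Real.exp (κ * x) : ℝ) : ℂ) * growthCoeff κ f x

/-- The derivative of `resolventFun`. -/
def resolventDeriv (κ : ℝ) (f : ℝ → ℂ) (w : ℂ) (x : ℝ) : ℂ :=
  ((-κ * Real.exp (-κ * x) : ℝ) : ℂ) * decayCoeff κ f w x +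
    ((κ * Real.exp (κ * x) : ℝ) : ℂ) * growthCoeff κ f x

variable {κ : ℝ} {f : ℝ → ℂ}

lemma integrableOn_Ioc_exp_mul (hκ : 0 < κ) (hf : MemLp f 2 halfLine) {h : ℝ → ℂ}
    (hh : Continuous h) (R : ℝ) : IntegrableOn (fun y => h y * f y) (Ioc 0 R) := by
  have h1 : IntegrableOn (fun y => ((Real.exp (-κ * y) : ℝ) : ℂ) * f y) (Icc 0 R) :=
    IntegrableOn.mono_set (integrable_exp_mul_halfLine hκ hf) fun y hy => hy.1
  have h2 := (h1.continuousOn_mul (g := fun y => h y * ((Real.exp (κ * y) : ℝ) : ℂ))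
    (by fun_prop) isCompact_Icc).mono_set Ioc_subset_Icc_self
  refine h2.congr_fun (fun y _ => ?_) measurableSet_Ioc
  have e : ((Real.exp (κ * y) : ℝ) : ℂ) * ((Real.exp (-κ * y) : ℝ) : ℂ) = 1 := by
    rw [← Complex.ofReal_mul, ← Real.exp_add]
    simp
  linear_combination h y * f y * e

lemma integral_Ioc_exp_abs_mul {x : ℝ} (hx : 0 ≤ x) :
    ((Real.exp (-κ * x) : ℝ) : ℂ) *
        ∫ y in (0 : ℝ)..x, ((κ / 2 * Real.exp (κ * y) : ℝ) : ℂ) * f y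
      = ∫ y in Ioc 0 x, ((κ / 2 * Real.exp (-κ * |x - y|) : ℝ) : ℂ) * f y := by
  rw [intervalIntegral.integral_of_le hx, ← integral_const_mul]
  refine setIntegral_congr_fun measurableSet_Ioc fun y hy => ?_
  have e : Real.exp (-κ * |x - y|) = Real.exp (-κ * x) * Real.exp (κ * y) := by
    rw [abs_of_nonneg (sub_nonneg.2 hy.2), ← Real.exp_add]
    ring_nf
  simp only [e]
  push_cast
  ring

/-- The constant in `growthCoeff` is the full integral over the half-line, so a tail integral
remains and the growth of `exp (κ x)` is compensated. -/
lemma exp_mul_growthCoeff (hκ : 0 < κ) (hf : MemLp f 2 halfLine) {x : ℝ} (hx : 0 ≤ x) :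
    ((Real.exp (κ * x) : ℝ) : ℂ) * growthCoeff κ f x
      = ∫ y in Ioi x, ((κ / 2 * Real.exp (-κ * |x - y|) : ℝ) : ℂ) * f y := by
  have hi := integrable_exp_mul_halfLine hκ hf
  have h1 : growthCoeff κ f x
      = ((κ / 2 : ℝ) : ℂ) * ∫ y in Ioi x, ((Real.exp (-κ * y) : ℝ) : ℂ) * f y := by
    rw [halfLine_eq_add hx] at hi
    have e : ∀ y, ((-(κ / 2) * Real.exp (-κ * y) : ℝ) : ℂ) * f y
        = -((κ / 2 : ℝ) : ℂ) * (((Real.exp (-κ * y) : ℝ) : ℂ) * f y) := fun y => by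
      push_cast
      ring
    rw [growthCoeff, halfLine_eq_add hx,
      integral_add_measure hi.left_of_add_measure hi.right_of_add_measure,
      intervalIntegral.integral_of_le hx]
    simp only [e]
    rw [integral_const_mul]
    ring
  rw [h1, ← integral_const_mul, ← integral_const_mul]
  refine setIntegral_congr_fun measurableSet_Ioi fun y hy => ?_
  have e : Real.exp (-κ * |x - y|) = Real.exp (κ * x) * Real.exp (-κ * y) := by
    rw [abs_of_neg (sub_neg.2 hy), ← Real.exp_add]
    ring_nf
  simp only [e]
  push_cast
  ring

lemma integrable_kernel_mul (hκ : 0 < κ) (hf : MemLp f 2 halfLine) (x : ℝ) :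
    Integrable (fun y => ((κ / 2 * Real.exp (-κ * |x - y|) : ℝ) : ℂ) * f y) halfLine := by
  refine ((integrable_exp_abs_mul_halfLine hκ hf x).const_mul ((κ / 2 : ℝ) : ℂ)).congr
    (ae_of_all _ fun y => ?_)
  push_cast
  ring

/-- Variation of constants suits differentiation; this convolution form gives the `L²` bounds and
the kernel. -/
lemma resolventFun_eq (hκ : 0 < κ) (hf : MemLp f 2 halfLine) (w : ℂ) {x : ℝ} (hx : 0 ≤ x) :
    resolventFun κ f w x = ∫ y, ((κ / 2 * Real.exp (-κ * |x - y|) : ℝ) : ℂ) * f y ∂halfLine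
      + ((Real.exp (-κ * x) : ℝ) : ℂ) * w := by
  have hi := integrable_kernel_mul hκ hf x
  rw [halfLine_eq_add hx] at hi
  rw [resolventFun, decayCoeff, mul_add, integral_Ioc_exp_abs_mul hx,
    exp_mul_growthCoeff hκ hf hx, halfLine_eq_add hx,
    integral_add_measure hi.left_of_add_measure hi.right_of_add_measure]
  ring

lemma norm_integral_kernel_mul_le (hκ : 0 < κ) (hf : MemLp f 2 halfLine) (x : ℝ) {s : Set ℝ}
    (hs : s ⊆ Ici 0) :
    ‖∫ y in s, ((κ / 2 * Real.exp (-κ * |x - y|) : ℝ) : ℂ) * f y‖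
      ≤ κ / 2 * ∫ y, Real.exp (-κ * |x - y|) * ‖f y‖ ∂halfLine := by
  have e : ∀ y, ‖((κ / 2 * Real.exp (-κ * |x - y|) : ℝ) : ℂ) * f y‖
      = κ / 2 * (Real.exp (-κ * |x - y|) * ‖f y‖) := fun y => by
    rw [norm_mul, Complex.norm_real, Real.norm_of_nonneg (by positivity), mul_assoc]
  refine (norm_integral_le_integral_norm _).trans ?_
  rw [← integral_const_mul]
  simp only [← e]
  exact integral_mono_measure (Measure.restrict_mono hs le_rfl) (ae_of_all _ fun y => norm_nonneg _)
    (integrable_kernel_mul hκ hf x).norm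

lemma continuousOn_primitive_halfLine {p : ℝ → ℂ} (hp : ∀ R, IntegrableOn p (Ioc 0 R)) :
    ContinuousOn (fun x => ∫ y in (0 : ℝ)..x, p y) (Ici 0) := by
  intro x (hx : 0 ≤ x)
  have h := intervalIntegral.continuousOn_primitive_interval (a := 0) (b := x + 1) (f := p)
    (μ := volume) (by
      rw [uIcc_of_le (by positivity)]
      exact (integrableOn_Icc_iff_integrableOn_Ioc).2 (hp (x + 1)))
  rw [uIcc_of_le (by positivity)] at h
  refine (h x ⟨hx, by linarith⟩).mono_of_mem_nhdsWithin ?_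
  filter_upwards [self_mem_nhdsWithin, mem_nhdsWithin_of_mem_nhds (Iio_mem_nhds (lt_add_one x))]
    with y hy hy'
  exact ⟨hy, le_of_lt hy'⟩

lemma continuousOn_decayCoeff (hκ : 0 < κ) (hf : MemLp f 2 halfLine) (w : ℂ) :
    ContinuousOn (decayCoeff κ f w) (Ici 0) :=
  continuousOn_const.add (continuousOn_primitive_halfLine
    (integrableOn_Ioc_exp_mul hκ hf (h := fun y => ((κ / 2 * Real.exp (κ * y) : ℝ) : ℂ))
      (by fun_prop)))

lemma continuousOn_growthCoeff (hκ : 0 < κ) (hf : MemLp f 2 halfLine) :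
    ContinuousOn (growthCoeff κ f) (Ici 0) :=
  continuousOn_const.add (continuousOn_primitive_halfLine
    (integrableOn_Ioc_exp_mul hκ hf (h := fun y => ((-(κ / 2) * Real.exp (-κ * y) : ℝ) : ℂ))
      (by fun_prop)))

lemma continuousOn_resolventFun (hκ : 0 < κ) (hf : MemLp f 2 halfLine) (w : ℂ) :
    ContinuousOn (resolventFun κ f w) (Ici 0) :=
  ((by fun_prop : Continuous fun x : ℝ =>
    ((Real.exp (-κ * x) : ℝ) : ℂ)).continuousOn.mul (continuousOn_decayCoeff hκ hf w)).add
  ((by fun_prop : Continuous fun x : ℝ =>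
    ((Real.exp (κ * x) : ℝ) : ℂ)).continuousOn.mul (continuousOn_growthCoeff hκ hf))

lemma continuousOn_resolventDeriv (hκ : 0 < κ) (hf : MemLp f 2 halfLine) (w : ℂ) :
    ContinuousOn (resolventDeriv κ f w) (Ici 0) :=
  ((by fun_prop : Continuous fun x : ℝ =>
    ((-κ * Real.exp (-κ * x) : ℝ) : ℂ)).continuousOn.mul (continuousOn_decayCoeff hκ hf w)).add
  ((by fun_prop : Continuous fun x : ℝ =>
    ((κ * Real.exp (κ * x) : ℝ) : ℂ)).continuousOn.mul (continuousOn_growthCoeff hκ hf))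

lemma norm_resolvent_le (hκ : 0 < κ) (hf : MemLp f 2 halfLine) (w : ℂ) {x : ℝ} (hx : 0 ≤ x) :
    ‖resolventFun κ f w x‖ ≤ κ / 2 * (∫ y, Real.exp (-κ * |x - y|) * ‖f y‖ ∂halfLine)
        + ‖w‖ * Real.exp (-κ * x) ∧
    ‖resolventDeriv κ f w x‖ ≤ κ * (κ * (∫ y, Real.exp (-κ * |x - y|) * ‖f y‖ ∂halfLine)
        + ‖w‖ * Real.exp (-κ * x)) := by
  have hw : ‖((Real.exp (-κ * x) : ℝ) : ℂ) * w‖ = ‖w‖ * Real.exp (-κ * x) := by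
    rw [norm_mul, Complex.norm_real, Real.norm_of_nonneg (Real.exp_nonneg _), mul_comm]
  constructor
  · rw [resolventFun_eq hκ hf w hx, ← hw]
    exact (norm_add_le _ _).trans
      (add_le_add_left (norm_integral_kernel_mul_le hκ hf x subset_rfl) _)
  -- The integrals over `y ≤ x` and `y > x` now have opposite signs. Each is bounded by the integral
  -- over the half-line, whence `κ` in place of `κ / 2`.
  · have e : resolventDeriv κ f w x = (κ : ℂ) *
        (-(∫ y in Ioc 0 x, ((κ / 2 * Real.exp (-κ * |x - y|) : ℝ) : ℂ) * f y)
        + (∫ y in Ioi x, ((κ / 2 * Real.exp (-κ * |x - y|) : ℝ) : ℂ) * f y)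
        - ((Real.exp (-κ * x) : ℝ) : ℂ) * w) := by
      rw [← exp_mul_growthCoeff hκ hf hx, ← integral_Ioc_exp_abs_mul hx, resolventDeriv, decayCoeff]
      push_cast
      ring
    rw [e, norm_mul, Complex.norm_real, Real.norm_of_nonneg hκ.le]
    refine mul_le_mul_of_nonneg_left ?_ hκ.le
    have h1 := norm_integral_kernel_mul_le hκ hf x (s := Ioc 0 x) fun y hy => hy.1.le
    have h2 := norm_integral_kernel_mul_le hκ hf x (s := Ioi x) fun y hy => hx.trans (le_of_lt hy)
    refine (norm_sub_le _ _).trans ?_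
    rw [hw]
    refine add_le_add_left ((norm_add_le _ _).trans ?_) _
    rw [norm_neg]
    linarith

lemma memLp_resolvent (hκ : 0 < κ) (hf : MemLp f 2 halfLine) (w : ℂ) :
    MemLp (resolventFun κ f w) 2 halfLine ∧ MemLp (resolventDeriv κ f w) 2 halfLine := by
  have hN := memLp_integral_exp_abs_mul hκ hf
  have hE := (memLp_exp_halfLine hκ).const_mul ‖w‖
  constructor
  · refine ((hN.const_mul (κ / 2)).add hE).mono'
      ((continuousOn_resolventFun hκ hf w).aestronglyMeasurable measurableSet_Ici) ?_
    exact (ae_restrict_mem measurableSet_Ici).mono fun x hx => (norm_resolvent_le hκ hf w hx).1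
  · refine (((hN.const_mul κ).add hE).const_mul κ).mono'
      ((continuousOn_resolventDeriv hκ hf w).aestronglyMeasurable measurableSet_Ici) ?_
    exact (ae_restrict_mem measurableSet_Ici).mono fun x hx => (norm_resolvent_le hκ hf w hx).2

lemma hasDerivAt_ofReal_const_mul_exp (a b x : ℝ) :
    HasDerivAt (fun x : ℝ => ((a * Real.exp (b * x) : ℝ) : ℂ))
      ((a * b * Real.exp (b * x) : ℝ) : ℂ) x := by
  have h := ((((hasDerivAt_id x).const_mul b).exp).const_mul a).ofReal_comp
  convert! h using 1
  simp only [id]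
  push_cast
  ring

/-- Weak differentiation of `a exp (-κ x) decayCoeff + b exp (κ x) growthCoeff`. -/
lemma integral_combination_mul_deriv (hκ : 0 < κ) (hf : MemLp f 2 halfLine) (w : ℂ) (a b : ℝ)
    {φ : ℝ → ℂ} (hφ : ContDiff ℝ ∞ φ) (hφc : HasCompactSupport φ) (hφ0 : tsupport φ ⊆ Ioi 0) :
    ∫ x, (((a * Real.exp (-κ * x) : ℝ) : ℂ) * decayCoeff κ f w x
        + ((b * Real.exp (κ * x) : ℝ) : ℂ) * growthCoeff κ f x) * deriv φ x ∂halfLine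
      = -∫ x, (((a * -κ * Real.exp (-κ * x) : ℝ) : ℂ) * decayCoeff κ f w x
        + ((b * κ * Real.exp (κ * x) : ℝ) : ℂ) * growthCoeff κ f x
        + ((κ / 2 * (a - b) : ℝ) : ℂ) * f x) * φ x ∂halfLine := by
  obtain ⟨i1, j1, e1⟩ := integral_mul_primitive_mul_deriv w
    (hasDerivAt_ofReal_const_mul_exp a (-κ)) (by fun_prop)
    (fun R _ => integrableOn_Ioc_exp_mul hκ hf
      (h := fun y => ((κ / 2 * Real.exp (κ * y) : ℝ) : ℂ)) (by fun_prop) R) hφ hφc hφ0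
  obtain ⟨i2, j2, e2⟩ := integral_mul_primitive_mul_deriv
    (((κ / 2 : ℝ) : ℂ) * (∫ y, ((Real.exp (-κ * y) : ℝ) : ℂ) * f y ∂halfLine))
    (hasDerivAt_ofReal_const_mul_exp b κ) (by fun_prop)
    (fun R _ => integrableOn_Ioc_exp_mul hκ hf
      (h := fun y => ((-(κ / 2) * Real.exp (-κ * y) : ℝ) : ℂ)) (by fun_prop) R) hφ hφc hφ0
  have hd : ∀ x, w + ∫ y in (0 : ℝ)..x, ((κ / 2 * Real.exp (κ * y) : ℝ) : ℂ) * f y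
      = decayCoeff κ f w x := fun _ => rfl
  have hg : ∀ x, ((κ / 2 : ℝ) : ℂ) * (∫ y, ((Real.exp (-κ * y) : ℝ) : ℂ) * f y ∂halfLine) +
      ∫ y in (0 : ℝ)..x, ((-(κ / 2) * Real.exp (-κ * y) : ℝ) : ℂ) * f y
      = growthCoeff κ f x := fun _ => rfl
  simp only [hd] at i1 j1 e1
  simp only [hg] at i2 j2 e2
  -- Differentiating the coefficients produces `exp (-κ x) exp (κ x) = 1` times `f`, so only `κ/2 (a
  -- - b) f` is left.
  have e : ∀ x, (((a * -κ * Real.exp (-κ * x) : ℝ) : ℂ) * decayCoeff κ f w x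
        + ((b * κ * Real.exp (κ * x) : ℝ) : ℂ) * growthCoeff κ f x
        + ((κ / 2 * (a - b) : ℝ) : ℂ) * f x) * φ x
      = (((a * -κ * Real.exp (-κ * x) : ℝ) : ℂ) * decayCoeff κ f w x
        + ((a * Real.exp (-κ * x) : ℝ) : ℂ) * (((κ / 2 * Real.exp (κ * x) : ℝ) : ℂ) * f x)) * φ x
      + (((b * κ * Real.exp (κ * x) : ℝ) : ℂ) * growthCoeff κ f x
        + ((b * Real.exp (κ * x) : ℝ) : ℂ) * (((-(κ / 2) * Real.exp (-κ * x) : ℝ) : ℂ) * f x))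
        * φ x := by
    intro x
    have h : ((Real.exp (-κ * x) : ℝ) : ℂ) * ((Real.exp (κ * x) : ℝ) : ℂ) = 1 := by
      rw [← Complex.ofReal_mul, ← Real.exp_add]
      simp
    push_cast
    push_cast at h
    linear_combination (-(a - b) * κ / 2 * f x * φ x) * h
  simp only [e, add_mul (_ * decayCoeff κ f w _) (_ * growthCoeff κ f _)]
  rw [integral_add j1 j2, neg_add, integral_add i1 i2, e1, e2]

end PointInteraction
end

noncomputable section

namespace PointInteraction

/-! ### The resolvent of `Δ(A,B)` -/

/-- The Laplace transform at `κ` of a pair of functions on the half-line. -/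
def laplaceAt (κ : ℝ) (f : L2Sum) (i : Fin 2) : ℂ :=
  ∫ y, ((Real.exp (-κ * y) : ℝ) : ℂ) * f i y ∂halfLine

variable {A B : Matrix (Fin 2) (Fin 2) ℂ} {κ : ℝ}

/-- With `c = (κ/2) laplaceAt κ f`, the solution has `u(0) = c + w` and `u'(0) = κ (c - w)`, so
`hbc` is the boundary condition. -/
lemma exists_isLaplacian (hκ : 0 < κ) (f : L2Sum) (w : Fin 2 → ℂ)
    (hbc : A *ᵥ (((κ / 2 : ℝ) : ℂ) • laplaceAt κ f + w)
      + B *ᵥ ((κ : ℂ) • (((κ / 2 : ℝ) : ℂ) • laplaceAt κ f - w)) = 0) :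
    ∃ u : L2Sum, IsLaplacian A B u (((κ ^ 2 : ℝ) : ℂ) • (u - f)) ∧
      ∀ i, u i =ᵐ[halfLine] resolventFun κ (f i) (w i) := by
  have hf : ∀ i, MemLp (f i) 2 halfLine := fun i => Lp.memLp (f i)
  have hm := fun i => memLp_resolvent hκ (hf i) (w i)
  set u : L2Sum := WithLp.toLp 2 fun i => (hm i).1.toLp _ with hu
  set v : L2Sum := WithLp.toLp 2 fun i => (hm i).2.toLp _ with hv
  have hui : ∀ i, u i =ᵐ[halfLine] resolventFun κ (f i) (w i) := fun i => (hm i).1.coeFn_toLp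
  have hvi : ∀ i, v i =ᵐ[halfLine] resolventDeriv κ (f i) (w i) := fun i => (hm i).2.coeFn_toLp
  refine ⟨u, ⟨v, fun i φ hφ hφc hφ0 => ?_, fun i φ hφ hφc hφ0 => ?_, _, _,
    fun i => ⟨_, continuousOn_resolventFun hκ (hf i) (w i), hui i, ?_⟩,
    fun i => ⟨_, continuousOn_resolventDeriv hκ (hf i) (w i), hvi i, ?_⟩, hbc⟩, hui⟩
  -- For `a = b = 1` the term in `f` drops out; below, `a = -κ`, `b = κ` leave the inhomogeneity
  -- `-κ² f`.
  · have h := integral_combination_mul_deriv hκ (hf i) (w i) 1 1 hφ hφc hφ0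
    have e1 : ∫ x, u i x * deriv φ x ∂halfLine
        = ∫ x, (((1 * Real.exp (-κ * x) : ℝ) : ℂ) * decayCoeff κ (f i) (w i) x
        + ((1 * Real.exp (κ * x) : ℝ) : ℂ) * growthCoeff κ (f i) x) * deriv φ x ∂halfLine :=
      integral_congr_ae ((hui i).mono fun x hx => by simp only [hx, resolventFun, one_mul])
    have e2 : ∫ x, v i x * φ x ∂halfLine
        = ∫ x, (((1 * -κ * Real.exp (-κ * x) : ℝ) : ℂ) * decayCoeff κ (f i) (w i) x
        + ((1 * κ * Real.exp (κ * x) : ℝ) : ℂ) * growthCoeff κ (f i) x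
        + ((κ / 2 * (1 - 1) : ℝ) : ℂ) * f i x) * φ x ∂halfLine :=
      integral_congr_ae ((hvi i).mono fun x hx => by
        simp only [hx, resolventDeriv, one_mul, sub_self, mul_zero, Complex.ofReal_zero, zero_mul,
          add_zero])
    rw [e1, e2, h]
  · have h := integral_combination_mul_deriv hκ (hf i) (w i) (-κ) κ hφ hφc hφ0
    have e1 : ∫ x, v i x * deriv φ x ∂halfLine
        = ∫ x, (((-κ * Real.exp (-κ * x) : ℝ) : ℂ) * decayCoeff κ (f i) (w i) x
        + ((κ * Real.exp (κ * x) : ℝ) : ℂ) * growthCoeff κ (f i) x) * deriv φ x ∂halfLine :=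
      integral_congr_ae ((hvi i).mono fun x hx => by simp only [hx, resolventDeriv])
    have e3 : (((κ ^ 2 : ℝ) : ℂ) • (u - f)) i =ᵐ[halfLine]
        fun x => ((κ ^ 2 : ℝ) : ℂ) * (resolventFun κ (f i) (w i) x - f i x) := by
      have : (((κ ^ 2 : ℝ) : ℂ) • (u - f)) i = ((κ ^ 2 : ℝ) : ℂ) • (u i - f i) := rfl
      rw [this]
      filter_upwards [Lp.coeFn_smul ((κ ^ 2 : ℝ) : ℂ) (u i - f i), Lp.coeFn_sub (u i) (f i), hui i]
        with x h1 h2 h3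
      rw [h1, Pi.smul_apply, h2, Pi.sub_apply, h3, smul_eq_mul]
    have e2 : ∫ x, (((κ ^ 2 : ℝ) : ℂ) • (u - f)) i x * φ x ∂halfLine
        = ∫ x, (((-κ * -κ * Real.exp (-κ * x) : ℝ) : ℂ) * decayCoeff κ (f i) (w i) x
        + ((κ * κ * Real.exp (κ * x) : ℝ) : ℂ) * growthCoeff κ (f i) x
        + ((κ / 2 * (-κ - κ) : ℝ) : ℂ) * f i x) * φ x ∂halfLine :=
      integral_congr_ae (e3.mono fun x hx => by
        simp only [hx, resolventFun]
        push_cast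
        ring)
    rw [e1, e2, h]
  · simp [resolventFun, decayCoeff, growthCoeff, laplaceAt, add_comm]
  · simp only [resolventDeriv, decayCoeff, growthCoeff, laplaceAt, mul_zero, Real.exp_zero,
      intervalIntegral.integral_same, Pi.smul_apply, Pi.sub_apply, smul_eq_mul]
    push_cast
    ring

lemma cayley_eq (A B : Matrix (Fin 2) (Fin 2) ℂ) (κ : ℝ) :
    cayley A B (Complex.I * κ) = -((A - (κ : ℂ) • B)⁻¹ * (A + (κ : ℂ) • B)) := by
  have : Complex.I * (Complex.I * κ) = -(κ : ℂ) := by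
    rw [← mul_assoc, Complex.I_mul_I, neg_one_mul]
  rw [cayley, this, neg_smul, sub_neg_eq_add, ← sub_eq_add_neg]

/-- Positive numbers `κ²` are no eigenvalues of a dissipative `Δ(A,B)`. -/
lemma isUnit_det_sub_smul {T : C0Semigroup L2Sum} (hT : T.IsContractive)
    (hgen : T.HasGenerator (IsLaplacian A B)) (hκ : 0 < κ) :
    IsUnit (A - (κ : ℂ) • B).det := by
  rw [isUnit_iff_ne_zero]
  intro hdet
  obtain ⟨w, hw0, hw⟩ := Matrix.exists_mulVec_eq_zero_iff.2 hdet
  have h0 : ∀ i : Fin 2, ((0 : L2Sum) i : ℝ → ℂ) =ᵐ[halfLine] 0 := fun i => Lp.coeFn_zero _ _ _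
  have hc : laplaceAt κ 0 = 0 := by
    funext i
    exact integral_eq_zero_of_ae ((h0 i).mono fun x hx => by simp only [hx, Pi.zero_apply, mul_zero])
  -- For `w` in the kernel of `A - κB`, the function `exp (-κ x) w` is an eigenfunction for `κ²`,
  -- which dissipativity forces to vanish.
  obtain ⟨u, hu, hui⟩ := exists_isLaplacian (A := A) (B := B) hκ 0 w (by
    rw [hc, smul_zero, zero_add, zero_sub, smul_neg, Matrix.mulVec_neg, Matrix.mulVec_smul,
      ← sub_eq_add_neg, ← Matrix.smul_mulVec, ← Matrix.sub_mulVec, hw])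
  have hu0 : u = 0 := by
    have h := hgen.norm_le hT hu (c := (κ ^ 2)⁻¹) (by positivity)
    have hκ2 : ((κ ^ 2 : ℝ) : ℂ) ≠ 0 := by exact_mod_cast (pow_pos hκ 2).ne'
    rw [sub_zero, smul_smul, Complex.ofReal_inv, inv_mul_cancel₀ hκ2, one_smul, sub_self,
      norm_zero] at h
    exact norm_le_zero_iff.1 h
  refine hw0 (funext fun i => ?_)
  have h1 : ∀ᵐ x ∂halfLine, w i = 0 := by
    filter_upwards [hui i, hu0 ▸ h0 i, ae_restrict_mem measurableSet_Ici] with x hx hx0 hxp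
    rw [hx0, resolventFun_eq hκ (Lp.memLp _) _ hxp, integral_eq_zero_of_ae
      ((h0 i).mono fun y hy => by simp only [hy, Pi.zero_apply, mul_zero]), zero_add, Pi.zero_apply] at hx
    exact (mul_eq_zero.1 hx.symm).resolve_left (by exact_mod_cast (Real.exp_pos _).ne')
  have : NeBot (ae halfLine) := by
    rw [ae_neBot]
    intro h
    have := congrArg (fun μ : Measure ℝ => μ univ) h
    simp at this
  simpa using h1.exists

/-- The integral operator only involves the kernel at points with equal coordinates. -/
lemma kernelMatrix_const (A B : Matrix (Fin 2) (Fin 2) ℂ) (κ x y : ℝ) :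
    kernelMatrix A B κ (fun _ => x) (fun _ => y)
      = ((κ / 2 * Real.exp (-κ * |x - y|) : ℝ) : ℂ) • (1 : Matrix (Fin 2) (Fin 2) ℂ)
        + ((κ / 2 * Real.exp (-κ * (x + y)) : ℝ) : ℂ) • cayley A B (Complex.I * κ) := by
  ext i j
  fin_cases i <;> fin_cases j <;> simp [kernelMatrix, -neg_mul] <;> ring

lemma kernelMatrix_mulVec_apply (A B : Matrix (Fin 2) (Fin 2) ℂ) (κ x y : ℝ) (ξ : Fin 2 → ℂ)
    (i : Fin 2) : (kernelMatrix A B κ (fun _ => x) (fun _ => y) *ᵥ ξ) i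
      = ((κ / 2 * Real.exp (-κ * |x - y|) : ℝ) : ℂ) * ξ i
        + ∑ j, ((κ / 2 * Real.exp (-κ * x) : ℝ) : ℂ) * cayley A B (Complex.I * κ) i j *
          (((Real.exp (-κ * y) : ℝ) : ℂ) * ξ j) := by
  have e : Real.exp (-κ * (x + y)) = Real.exp (-κ * x) * Real.exp (-κ * y) := by
    rw [mul_add, Real.exp_add]
  rw [kernelMatrix_const, Matrix.add_mulVec, Matrix.smul_mulVec, Matrix.smul_mulVec,
    Matrix.one_mulVec, Pi.add_apply, Pi.smul_apply, Pi.smul_apply, smul_eq_mul, smul_eq_mul, e,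
    Matrix.mulVec, dotProduct, Finset.mul_sum]
  congr 1
  refine Finset.sum_congr rfl fun j _ => ?_
  push_cast
  ring

lemma integrable_kernelMatrix_mulVec (A B : Matrix (Fin 2) (Fin 2) ℂ) (hκ : 0 < κ) (f : L2Sum)
    (x : ℝ) : Integrable (fun y => kernelMatrix A B κ (fun _ => x) (fun _ => y) *ᵥ
      fun i => f i y) halfLine := by
  refine Integrable.of_eval fun i => ?_
  have h1 := integrable_kernel_mul hκ (Lp.memLp (f i)) x
  have h2 : Integrable (fun y => ∑ j, ((κ / 2 * Real.exp (-κ * x) : ℝ) : ℂ) *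
      cayley A B (Complex.I * κ) i j * (((Real.exp (-κ * y) : ℝ) : ℂ) * f j y)) halfLine :=
    integrable_finsetSum _ fun j _ => (integrable_exp_mul_halfLine hκ (Lp.memLp (f j))).const_mul _
  refine (h1.add h2).congr (ae_of_all _ fun y => ?_)
  exact (kernelMatrix_mulVec_apply A B κ x y (fun i => f i y) i).symm

/-- The operator `κ² (κ² - Δ(A,B))⁻¹` is the integral operator with kernel `kernelMatrix A B κ`. -/
lemma exists_isLaplacian_kernelMatrix (hκ : 0 < κ) (hdet : IsUnit (A - (κ : ℂ) • B).det)
    (f : L2Sum) : ∃ u : L2Sum, IsLaplacian A B u (((κ ^ 2 : ℝ) : ℂ) • (u - f)) ∧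
      ∀ᵐ x ∂halfLine, (fun i => u i x) = ∫ y, kernelMatrix A B κ (fun _ => x) (fun _ => y) *ᵥ
        (fun i => f i y) ∂halfLine := by
  set S := cayley A B (Complex.I * κ) with hS
  have hMS : (A - (κ : ℂ) • B) * S = -(A + (κ : ℂ) • B) := by
    rw [hS, cayley_eq, mul_neg, ← mul_assoc, Matrix.mul_nonsing_inv _ hdet, one_mul]
  -- For `w = S c` the boundary condition reads `(A + κB) c + (A - κB) S c = 0`, which is `hMS`.
  obtain ⟨u, hu, hui⟩ := exists_isLaplacian (A := A) (B := B) hκ f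
    (((κ / 2 : ℝ) : ℂ) • (S *ᵥ laplaceAt κ f)) (by
      have h := congrArg (fun M => M *ᵥ laplaceAt κ f) hMS
      simp only [← Matrix.mulVec_mulVec, Matrix.neg_mulVec, Matrix.add_mulVec, Matrix.sub_mulVec,
        Matrix.smul_mulVec] at h
      rw [← smul_add, ← smul_sub, Matrix.mulVec_smul, Matrix.mulVec_smul, Matrix.mulVec_smul,
        Matrix.mulVec_add, Matrix.mulVec_sub, smul_comm, ← smul_add]
      convert! smul_zero _ using 2
      rw [smul_sub]
      linear_combination (exp := 1) h)
  refine ⟨u, hu, ?_⟩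
  filter_upwards [ae_all_iff.2 hui, ae_restrict_mem measurableSet_Ici] with x hx hxp
  funext i
  rw [hx i, resolventFun_eq hκ (Lp.memLp _) _ hxp,
    eval_integral fun i => (integrable_kernelMatrix_mulVec A B hκ f x).eval i]
  have h1 := integrable_kernel_mul hκ (Lp.memLp (f i)) x
  have h2 : ∀ j, Integrable (fun y => ((κ / 2 * Real.exp (-κ * x) : ℝ) : ℂ) * S i j *
      (((Real.exp (-κ * y) : ℝ) : ℂ) * f j y)) halfLine := fun j =>
    (integrable_exp_mul_halfLine hκ (Lp.memLp (f j))).const_mul _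
  simp only [kernelMatrix_mulVec_apply, ← hS]
  rw [integral_add h1 (integrable_finsetSum _ fun j _ => h2 j),
    integral_finsetSum _ fun j _ => h2 j]
  simp only [integral_const_mul, Pi.smul_apply, Matrix.mulVec, dotProduct, smul_eq_mul,
    Finset.mul_sum, laplaceAt]
  congr 1
  refine Finset.sum_congr rfl fun j _ => ?_
  push_cast
  ring

/-! ### Invariant sets -/

/-- Convergence in `L²` yields almost everywhere convergent subsequences; the second coordinate is
refined along the subsequence for the first. -/
lemma isClosed_inducedSet {C : Set (Fin 2 → ℂ)} (hC : IsClosed C) :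
    IsClosed (inducedSet C) := by
  refine IsSeqClosed.isClosed fun F f hF hlim => ?_
  have hcoord : ∀ i, Tendsto (fun n => F n i) atTop (𝓝 (f i)) := fun i =>
    ((PiLp.continuous_apply 2 _ i).tendsto f).comp hlim
  obtain ⟨n₀, hn₀, h₀⟩ := (tendstoInMeasure_of_tendsto_Lp (hcoord 0)).exists_seq_tendsto_ae
  obtain ⟨n₁, hn₁, h₁⟩ := (tendstoInMeasure_of_tendsto_Lp
    ((hcoord 1).comp hn₀.tendsto_atTop)).exists_seq_tendsto_ae
  have hall : ∀ᵐ x ∂halfLine, ∀ n, (fun i => F n i x) ∈ C := ae_all_iff.2 hF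
  change ∀ᵐ x ∂halfLine, (fun i => f i x) ∈ C
  filter_upwards [h₀, h₁, hall] with x hx₀ hx₁ hx
  refine hC.mem_of_tendsto (f := fun k i => F (n₀ (n₁ k)) i x) (b := atTop)
    (tendsto_pi_nhds.2 fun i => ?_) (Eventually.of_forall fun k => hx _)
  fin_cases i
  · exact hx₀.comp hn₁.tendsto_atTop
  · exact hx₁

/-- A closed set is invariant under the semigroup if the kernels of the resolvents average every
function with values in it to a value in it. -/
lemma apply_mem_inducedSet {T : C0Semigroup L2Sum} (hT : T.IsContractive)
    (hgen : T.HasGenerator (IsLaplacian A B)) {C : Set (Fin 2 → ℂ)} (hC : IsClosed C)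
    (hK : ∀ κ : ℝ, 0 < κ → ∀ f ∈ inducedSet C, ∀ x, 0 ≤ x →
      ∫ y, kernelMatrix A B κ (fun _ => x) (fun _ => y) *ᵥ (fun i => f i y) ∂halfLine ∈ C)
    (t : ℝ≥0) {f : L2Sum} (hf : f ∈ inducedSet C) : T.toFun t f ∈ inducedSet C := by
  refine hgen.apply_mem hT (isClosed_inducedSet hC) (fun l hl f => ?_) t hf
  have hκ := Real.sqrt_pos.2 hl
  obtain ⟨u, hu, hux⟩ := exists_isLaplacian_kernelMatrix hκ (isUnit_det_sub_smul hT hgen hκ) f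
  rw [Real.sq_sqrt hl.le] at hu
  refine ⟨u, hu, fun hfC => ?_⟩
  change ∀ᵐ x ∂halfLine, (fun i => u i x) ∈ C
  filter_upwards [hux, ae_restrict_mem measurableSet_Ici] with x hx hxp
  rw [hx]
  exact hK _ hκ f hfC x hxp

/-- Take `κ = 2r` and `x = y = n`: the direct term is `r` times the identity, and the reflected term
vanishes as `n → ∞`. -/
lemma smul_mem_of_leavesInvariant {C : Set (Fin 2 → ℂ)} (hC : IsClosed C)
    (h : ∀ κ : ℝ, 0 < κ → ∀ x y : ℝ, 0 ≤ x → 0 ≤ y →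
      LeavesInvariant (kernelMatrix A B κ (fun _ => x) (fun _ => y)) C)
    {r : ℝ} (hr : 0 < r) {c : Fin 2 → ℂ} (hc : c ∈ C) : r • c ∈ C := by
  have hlim : Tendsto (fun n : ℕ => Real.exp (-(2 * r) * ((n : ℝ) + n))) atTop (𝓝 0) := by
    refine Real.tendsto_exp_atBot.comp (Tendsto.const_mul_atTop_of_neg (by linarith) ?_)
    exact tendsto_natCast_atTop_atTop.atTop_add_atTop tendsto_natCast_atTop_atTop
  have hlim' : Tendsto (fun n : ℕ => ((r * Real.exp (-(2 * r) * ((n : ℝ) + n)) : ℝ) : ℂ) •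
      (cayley A B (Complex.I * ((2 * r : ℝ) : ℂ)) *ᵥ c)) atTop (𝓝 0) := by
    have h1 : Tendsto (fun n : ℕ => ((r * Real.exp (-(2 * r) * ((n : ℝ) + n)) : ℝ) : ℂ)) atTop
        (𝓝 0) := by
      have := (Complex.continuous_ofReal.tendsto _).comp (hlim.const_mul r)
      rwa [mul_zero, Complex.ofReal_zero] at this
    have h2 := h1.smul_const (cayley A B (Complex.I * ((2 * r : ℝ) : ℂ)) *ᵥ c)
    rwa [zero_smul] at h2
  have hlim2 := hlim'.const_add (r • c)
  rw [add_zero] at hlim2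
  refine hC.mem_of_tendsto hlim2 (Eventually.of_forall fun n => ?_)
  have h1 := h (2 * r) (by linarith) n n n.cast_nonneg n.cast_nonneg c hc
  rw [kernelMatrix_const, Matrix.add_mulVec, Matrix.smul_mulVec, Matrix.smul_mulVec,
    Matrix.one_mulVec, sub_self, abs_zero, mul_zero, Real.exp_zero, mul_one,
    mul_div_cancel_left₀ _ two_ne_zero, Complex.coe_smul] at h1
  exact h1

/-- Closed convex sets that are invariant under the kernels are invariant under the semigroup. -/
theorem apply_mem_inducedSet_of_convex {T : C0Semigroup L2Sum} (hT : T.IsContractive)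
    (hgen : T.HasGenerator (IsLaplacian A B)) {C : Set (Fin 2 → ℂ)} (hC : IsClosed C)
    (hconv : Convex ℝ C)
    (h : ∀ κ : ℝ, 0 < κ → ∀ x y : ℝ, 0 ≤ x → 0 ≤ y →
      LeavesInvariant (kernelMatrix A B κ (fun _ => x) (fun _ => y)) C)
    (t : ℝ≥0) {f : L2Sum} (hf : f ∈ inducedSet C) : T.toFun t f ∈ inducedSet C := by
  rcases C.eq_empty_or_nonempty with rfl | ⟨c, hc⟩
  · have hfalse : ∀ g : L2Sum, g ∈ inducedSet ∅ ↔ f ∈ inducedSet ∅ := fun g => by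
      simp [inducedSet]
    exact (hfalse _).2 hf
  have hcone : ∀ r : ℝ, 0 < r → ∀ c ∈ C, r • c ∈ C := fun r hr c hc =>
    smul_mem_of_leavesInvariant hC h hr hc
  have h0 : (0 : Fin 2 → ℂ) ∈ C := by
    have hlim : Tendsto (fun n : ℕ => (1 / ((n : ℝ) + 1)) • c) atTop (𝓝 0) := by
      simpa only [zero_smul] using
        (tendsto_one_div_add_atTop_nhds_zero_nat (𝕜 := ℝ)).smul_const c
    exact hC.mem_of_tendsto hlim (Eventually.of_forall fun n => hcone _ (by positivity) c hc)
  refine apply_mem_inducedSet hT hgen hC (fun κ hκ f hf x hx => ?_) t hf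
  refine integral_mem_of_cone hC hconv h0 hcone (integrable_kernelMatrix_mulVec A B hκ f x) ?_
  have hf : ∀ᵐ y ∂halfLine, (fun i => f i y) ∈ C := hf
  filter_upwards [hf, ae_restrict_mem measurableSet_Ici] with y hy hyp
  exact h κ hκ x y hx hyp _ hy

/-! ### Contractivity in `L^∞` -/

/-- The `ℓ¹` ball contains the basis vectors, whose images are the columns of `M`. -/
lemma norm_apply_le_one_of_leavesInvariant {M : Matrix (Fin 2) (Fin 2) ℂ}
    (h : LeavesInvariant M {ξ : Fin 2 → ℂ | ‖ξ 0‖ + ‖ξ 1‖ ≤ 1}) (i j : Fin 2) : ‖M i j‖ ≤ 1 := by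
  have h1 := h (Pi.single j 1) (by fin_cases j <;> simp)
  simp only [Matrix.mulVec_single_one, mem_ofPred_eq, Matrix.col_apply] at h1
  have h2 := norm_nonneg (M 0 j)
  have h3 := norm_nonneg (M 1 j)
  fin_cases i
  · exact le_trans (by simp) (le_trans (le_add_of_nonneg_right h3) h1)
  · exact le_trans (by simp) (le_trans (le_add_of_nonneg_left h2) h1)

/-- With `E = exp (-κ|x-y|) ≥ F = exp (-κ(x+y))`, the kernel is `κ/2 ((E - F) 1 + F (1 + S))`. The
rows of `1 + S` have absolute sum at most 2, and `(E - F) + 2F = E + F`. -/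
lemma norm_kernelMatrix_mulVec_le (hκ : 0 < κ)
    (h : ∀ i j, ‖(1 + cayley A B (Complex.I * κ)) i j‖ ≤ 1) {x y : ℝ} (hx : 0 ≤ x) (hy : 0 ≤ y)
    {ξ : Fin 2 → ℂ} {M : ℝ} (hξ : ∀ i, ‖ξ i‖ ≤ M) (i : Fin 2) :
    ‖(kernelMatrix A B κ (fun _ => x) (fun _ => y) *ᵥ ξ) i‖
      ≤ κ / 2 * M * (Real.exp (-κ * |x - y|) + Real.exp (-κ * x) * Real.exp (-κ * y)) := by
  set S := cayley A B (Complex.I * κ) with hS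
  have hM : 0 ≤ M := (norm_nonneg _).trans (hξ 0)
  set E := Real.exp (-κ * |x - y|) with hE
  set F := Real.exp (-κ * (x + y)) with hF
  have hEF : F ≤ E := by
    refine Real.exp_le_exp.2 ?_
    have : |x - y| ≤ x + y := abs_sub_le_iff.2 ⟨by linarith, by linarith⟩
    nlinarith
  have hF0 : 0 ≤ F := Real.exp_nonneg _
  have e : (kernelMatrix A B κ (fun _ => x) (fun _ => y) *ᵥ ξ) i
      = ((κ / 2 : ℝ) : ℂ) * (((E - F : ℝ) : ℂ) * ξ i + (F : ℂ) * (((1 + S) *ᵥ ξ) i)) := by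
    simp only [kernelMatrix_const, Matrix.add_mulVec, Matrix.smul_mulVec, ← hS, ← hE, ← hF,
      Matrix.one_mulVec, Pi.add_apply, Pi.smul_apply, smul_eq_mul]
    push_cast
    ring
  have h1 : ‖((1 + S) *ᵥ ξ) i‖ ≤ 2 * M := by
    rw [Matrix.mulVec, dotProduct, Fin.sum_univ_two, two_mul]
    refine (norm_add_le _ _).trans (add_le_add ?_ ?_) <;>
    · rw [norm_mul]
      exact (mul_le_mul (h _ _) (hξ _) (norm_nonneg _) zero_le_one).trans_eq (one_mul M)
  rw [e, norm_mul, Complex.norm_real, Real.norm_of_nonneg (by positivity), mul_assoc (κ / 2) M,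
    ← Real.exp_add, ← mul_add, ← hF]
  refine mul_le_mul_of_nonneg_left ?_ (by positivity)
  refine (norm_add_le _ _).trans ?_
  rw [norm_mul, norm_mul, Complex.norm_real, Complex.norm_real, Real.norm_of_nonneg hF0,
    Real.norm_of_nonneg (sub_nonneg.2 hEF)]
  have h2 := mul_le_mul_of_nonneg_left (hξ i) (sub_nonneg.2 hEF)
  have h3 := mul_le_mul_of_nonneg_left h1 hF0
  linarith

lemma apply_mem_inducedSet_polydisc {T : C0Semigroup L2Sum} (hT : T.IsContractive)
    (hgen : T.HasGenerator (IsLaplacian A B))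
    (h : ∀ κ : ℝ, 0 < κ → ∀ i j, ‖(1 + cayley A B (Complex.I * κ)) i j‖ ≤ 1) (M : ℝ)
    (t : ℝ≥0) {f : L2Sum} (hf : f ∈ inducedSet {ξ | ∀ i, ‖ξ i‖ ≤ M}) :
    T.toFun t f ∈ inducedSet {ξ | ∀ i, ‖ξ i‖ ≤ M} := by
  have hC : IsClosed {ξ : Fin 2 → ℂ | ∀ i, ‖ξ i‖ ≤ M} := by
    rw [ofPred_forall]
    exact isClosed_iInter fun i => isClosed_le (by fun_prop) continuous_const
  refine apply_mem_inducedSet hT hgen hC (fun κ hκ f hf x hx i => ?_) t hf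
  have hf : ∀ᵐ y ∂halfLine, ∀ i, ‖f i y‖ ≤ M := hf
  have hi := integrable_kernelMatrix_mulVec A B hκ f x
  have i1 := integrable_exp_abs_halfLine hκ x
  have i2 := (integrable_exp_halfLine hκ).const_mul (Real.exp (-κ * x))
  rw [eval_integral fun i => hi.eval i]
  calc _ ≤ ∫ y, κ / 2 * M * (Real.exp (-κ * |x - y|) + Real.exp (-κ * x) * Real.exp (-κ * y))
        ∂halfLine := by
        refine norm_integral_le_of_norm_le ((i1.add i2).const_mul _) ?_
        filter_upwards [hf, ae_restrict_mem measurableSet_Ici] with y hy hyp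
        exact norm_kernelMatrix_mulVec_le hκ (h κ hκ) hx hyp hy i
    -- The boundary deficit `-exp (-κ x)/κ` of the direct term is exactly made up by the reflected
    -- term, so no constant is lost.
    _ = M := by
        rw [integral_const_mul, integral_add i1 i2, integral_const_mul,
          integral_exp_abs_halfLine hκ hx, integral_exp_halfLine hκ]
        field_simp
        ring

/-- The semigroup is contractive in `L^∞` if all entries of `1 + 𝔖(iκ)` are at most one. -/
theorem supNorm_apply_le {T : C0Semigroup L2Sum} (hT : T.IsContractive)
    (hgen : T.HasGenerator (IsLaplacian A B))
    (h : ∀ κ : ℝ, 0 < κ → ∀ i j, ‖(1 + cayley A B (Complex.I * κ)) i j‖ ≤ 1)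
    (t : ℝ≥0) (f : L2Sum) : supNorm (T.toFun t f) ≤ supNorm f := by
  rcases eq_or_ne (supNorm f) ∞ with htop | htop
  · rw [htop]
    exact le_top
  have hf : f ∈ inducedSet {ξ | ∀ i, ‖ξ i‖ ≤ (supNorm f).toReal} := by
    refine ae_all_iff.2 fun i => ?_
    have h1 : eLpNorm (f i) ∞ halfLine ≤ supNorm f :=
      le_iSup (fun i => eLpNorm (f i) ∞ halfLine) i
    rw [eLpNorm_exponent_top] at h1
    filter_upwards [ae_le_eLpNormEssSup (f := f i) (μ := halfLine)] with x hx
    have := ENNReal.toReal_mono htop (hx.trans h1)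
    rwa [toReal_enorm] at this
  have hTf : ∀ᵐ x ∂halfLine, ∀ i, ‖T.toFun t f i x‖ ≤ (supNorm f).toReal :=
    apply_mem_inducedSet_polydisc hT hgen h _ t hf
  refine iSup_le fun i => ?_
  rw [eLpNorm_exponent_top, ← ENNReal.ofReal_toReal htop]
  exact eLpNormEssSup_le_of_ae_bound (hTf.mono fun x hx => hx i)

end PointInteraction
end

theorem lemma5p2 (A B : Matrix (Fin 2) (Fin 2) ℂ) (hreg : PointInteraction.IsRegular A B)
    (T : PointInteraction.C0Semigroup PointInteraction.L2Sum) (hT : T.IsContractive)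
    (hgen : T.HasGenerator (PointInteraction.IsLaplacian A B)) :
    (∀ C : Set (Fin 2 → ℂ), IsClosed C → Convex ℝ C →
      (∀ κ : ℝ, 0 < κ → ∀ x y : Fin 2 → ℝ, (∀ i, 0 ≤ x i) → (∀ j, 0 ≤ y j) →
        PointInteraction.LeavesInvariant (PointInteraction.kernelMatrix A B κ x y) C) →
      ∀ t : ℝ≥0, ∀ f ∈ PointInteraction.inducedSet C,
        T.toFun t f ∈ PointInteraction.inducedSet C) ∧
    ((∀ κ : ℝ, 0 < κ →
        PointInteraction.LeavesInvariant (1 + PointInteraction.cayley A B (Complex.I * κ))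
          {ξ : Fin 2 → ℂ | ‖ξ 0‖ + ‖ξ 1‖ ≤ 1}) →
      ∀ t : ℝ≥0, ∀ f : PointInteraction.L2Sum,
        PointInteraction.supNorm (T.toFun t f) ≤ PointInteraction.supNorm f) := by
  refine ⟨fun C hC hconv h t f hf => ?_, fun h t f => ?_⟩
  · exact PointInteraction.apply_mem_inducedSet_of_convex hT hgen hC hconv
      (fun κ hκ x y hx hy => h κ hκ _ _ (fun _ => hx) fun _ => hy) t hf
  · exact PointInteraction.supNorm_apply_le hT hgen
      (fun κ hκ i j => PointInteraction.norm_apply_le_one_of_leavesInvariant (h κ hκ) i j) t f
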